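/- \textbf{Setting.} Let $f_0,f_1$ be probability density functions on $\mathbb R$ whose distributions $P_0\ne P_1$ are mutually absolutely continuous, let $\pi_0\in[0,1]$ and $c>0$. There are infinitely many independent sequences. Each satisfies hypothesis $H_1$ with probability $\pi_0$ and $H_0$ otherwise; given the hypothesis $H_i$, the samples $Y^s_1,Y^s_2,\dots$ of sequence $s$ are i.i.d. with density $f_i$. \emph{Scanning stage.} At slot $k\ge 1$ one observes $Z_k=Y_k^{s_k^1}+Y_k^{s_k^2}$; put $\mathcal F_k=\sigma(Z_1,\dots,Z_k)$. A switching rule $\phi=(\phi_k)$ consists of $\{0,1\}$-valued, $\mathcal F_k$-measurable $\phi_k$; if $\phi_k=1$ the pair $(s^1_{k+1},s^2_{k+1})$ is the next pair of sequences not used before, and if $\phi_k=0$ it equals $(s_k^1,s_k^2)$. The stage ends at an almost surely finite stopping time $\tau_0$ of $(\mathcal F_k)_{k\ge0}$. \emph{Refinement stage.} One then observes $X_j=Y^{s^1_{\tau_0}}_{\tau_0+j}$, $j\ge1$; put $\mathcal G_j=\sigma(Z_1,\dots,Z_{\tau_0},X_1,\dots,X_j)$, so $\mathcal G_0=\mathcal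 F_{\tau_0}$. For $a,b\in\{0,1\}$ let $r_j^{a,b}$ be the conditional probability given $\mathcal G_j$ that $s_{\tau_0}^1$ satisfies $H_a$ and $s_{\tau_0}^2$ satisfies $H_b$, let $\mathbf r_j=(r_j^{1,1},r_j^{1,0},r_j^{0,1},r_j^{0,0})$, and let $q_{1,j}=r_j^{1,1}+r_j^{1,0}$, $q_{2,j}=r_j^{1,1}+r_j^{0,1}$. The refinement cost is $$v(\tau_0,\phi)=\operatorname*{ess\,inf}_{\tau_1}\ \mathbb E\bigl[c\,\tau_1+1-\max\{q_{1,\tau_1},q_{2,\tau_1}\}\,\big|\,\mathcal F_{\tau_0}\bigr],$$ over all stopping times $\tau_1$ of $(\mathcal G_j)_{j\ge 0}$ with values in $\{0,1,2,\dots\}\cup\{\infty\}$ (the cost is $\infty$ where $\tau_1=\infty$). \emph{Bellman equation.} For a probability vector $r=(r^{1,1},r^{1,0},r^{0,1},r^{0,0})$ write $q_1=r^{1,1}+r^{1,0}$, $q_2=r^{1,1}+r^{0,1}$ and $f(x\mid r)=q_1f_1(x)+(1-q_1)f_0(x)$; let $B(r,x)$ be the vector with entries $B(r,x)^{a,b}=f_a(x)\,r^{a,b}/f(x\mid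 r)$, and $$(\mathcal PV)(r)=\int_{\mathbb R}V(B(r,x))\,f(x\mid r)\,dx .$$ The Bellman equation is $$V(r)=\min\bigl\{1-\max\{q_1,q_2\},\ c+(\mathcal PV)(r)\bigr\}\quad\text{for all probability vectors } r. \tag{$*$}$$ \textbf{Theorem.} Given $f_0,f_1,c$, equation $(*)$ has a bounded measurable solution $V$. Let $V$ be any bounded measurable solution of $(*)$. Then for every $\pi_0$, every switching rule $\phi$ and every almost surely finite stopping time $\tau_0$ as above: \begin{enumerate} \item $v(\tau_0,\phi)=V(\mathbf r_0)\ge 0$ almost surely. \item For every $j\ge0$, $V(\mathbf r_{j+1})$ is integrable, $\mathbb E[V(\mathbf r_{j+1})\mid\mathbf r_j]=(\mathcal PV)(\mathbf r_j)$ almost surely, and almost surely $$V(\mathbf r_j)=\min\bigl\{1-\max\{q_{1,j},q_{2,j}\},\ c+\mathbb E[V(\mathbf r_{j+1})\mid\mathbf r_j]\bigr\}.$$ \item The time $$\tau_1^*=\inf\bigl\{j\ge0:\ 1-\max\{q_{1,j},q_{2,j}\}\le c+(\mathcal PV)(\mathbf r_j)\bigr\}$$ is a stopping time of $(\mathcal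 G_j)$ and is optimal: $\mathbb E[c\,\tau_1^*+1-\max\{q_{1,\tau_1^*},q_{2,\tau_1^*}\}\mid\mathcal F_{\tau_0}]=v(\tau_0,\phi)$ almost surely. \end{enumerate} -/

import Mathlib

open MeasureTheory ProbabilityTheory
open scoped ENNReal

noncomputable section

namespace MixedSearch

/-! ### The statistical model -/

/-- `f` is a probability density function on `ℝ` with respect to Lebesgue measure. -/
structure IsPDF (f : ℝ → ℝ) : Prop where
  measurable : Measurable f
  nonneg : ∀ x, 0 ≤ f x
  lintegral_eq_one : ∫⁻ x, ENNReal.ofReal (f x) = 1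

/-- The probability measure with density `f`. -/
def pdfMeasure (f : ℝ → ℝ) : Measure ℝ :=
  volume.withDensity fun x => ENNReal.ofReal (f x)

/-- The joint law of the hypothesis of one sequence (`true` for `H₁`, `false` for `H₀`) and of the
samples of that sequence: `H₁` has prior probability `π₀`, and given the hypothesis the samples are
i.i.d. with density `f₁` under `H₁` and `f₀` under `H₀`. -/
def sequenceLaw (f₀ f₁ : ℝ → ℝ) (π₀ : ℝ) : Measure (Bool × (ℕ → ℝ)) :=
  ENNReal.ofReal π₀ •
      (Measure.dirac true).prod (Measure.infinitePi fun _ : ℕ => pdfMeasure f₁) +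
    ENNReal.ofReal (1 - π₀) •
      (Measure.dirac false).prod (Measure.infinitePi fun _ : ℕ => pdfMeasure f₀)

/-- `θ s` is the hypothesis of sequence `s` and `Y s k` its sample at time slot `k`; the sequences
are independent of each other and each has the law `sequenceLaw`. Only the slots `k ≥ 1` are ever
observed. -/
structure IsSearchModel {Ω : Type*} [MeasurableSpace Ω] (f₀ f₁ : ℝ → ℝ) (π₀ : ℝ) (μ : Measure Ω)
    (θ : ℕ → Ω → Bool) (Y : ℕ → ℕ → Ω → ℝ) : Prop where
  measurable_hyp : ∀ s, Measurable (θ s)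
  measurable_sample : ∀ s k, Measurable (Y s k)
  indep : iIndepFun (fun (s : ℕ) (ω : Ω) => (θ s ω, fun k => Y s k ω)) μ
  law : ∀ s, μ.map (fun ω => (θ s ω, fun k => Y s k ω)) = sequenceLaw f₀ f₁ π₀

/-! ### The scanning stage -/

section Scan

variable {Ω : Type*}

/-- The number of switches made before slot `k`. With `n = pairIndex φ k ω`, the pair
`(s_k¹, s_k²)` observed at slot `k` is `(2 n, 2 n + 1)`: each switch moves on to the next,
never yet used, pair. Here `φ i ω = true` means that the observer switches after slot `i`. -/
def pairIndex (φ : ℕ → Ω → Bool) (k : ℕ) (ω : Ω) : ℕ :=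
  ∑ i ∈ Finset.range k, (φ i ω).toNat

/-- The mixed observation `Z_k`. -/
def scanObs (Y : ℕ → ℕ → Ω → ℝ) (φ : ℕ → Ω → Bool) (k : ℕ) (ω : Ω) : ℝ :=
  Y (2 * pairIndex φ k ω) k ω + Y (2 * pairIndex φ k ω + 1) k ω

/-- `σ(Z_1, …, Z_k)`. -/
@[reducible] def scanInfo (Y : ℕ → ℕ → Ω → ℝ) (φ : ℕ → Ω → Bool) (k : ℕ) : MeasurableSpace Ω :=
  ⨆ i ∈ Finset.Icc 1 k, MeasurableSpace.comap (scanObs Y φ i) inferInstance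

/-- Every switching decision is a function of the observations made so far. -/
def IsSwitchingRule (Y : ℕ → ℕ → Ω → ℝ) (φ : ℕ → Ω → Bool) : Prop :=
  ∀ k, Measurable[scanInfo Y φ k] (φ k)

variable [mΩ : MeasurableSpace Ω]

theorem measurable_select {Y : ℕ → ℕ → Ω → ℝ} (hY : ∀ s k, Measurable (Y s k))
    {S K : Ω → ℕ} (hS : Measurable S) (hK : Measurable K) :
    Measurable fun ω => Y (S ω) (K ω) ω := by
  have h : Measurable fun p : (ℕ × ℕ) × Ω => Y p.1.1 p.1.2 p.2 :=
    measurable_from_prod_countable_right fun q => hY q.1 q.2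
  exact h.comp ((hS.prodMk hK).prodMk measurable_id)

theorem measurable_pairIndex {φ : ℕ → Ω → Bool} {k : ℕ} (h : ∀ i < k, Measurable (φ i)) :
    Measurable (pairIndex φ k) := by
  unfold pairIndex
  refine Finset.measurable_sum _ fun i hi => ?_
  exact (measurable_from_top (f := Bool.toNat)).comp (h i (Finset.mem_range.1 hi))

theorem measurable_scanObs_of {Y : ℕ → ℕ → Ω → ℝ} (hY : ∀ s k, Measurable (Y s k))
    {φ : ℕ → Ω → Bool} {k : ℕ} (h : ∀ i < k, Measurable (φ i)) : Measurable (scanObs Y φ k) := by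
  have hp := measurable_pairIndex h
  exact (measurable_select hY (hp.const_mul 2) measurable_const).add
    (measurable_select hY ((hp.const_mul 2).add_const 1) measurable_const)

theorem measurable_rule {Y : ℕ → ℕ → Ω → ℝ} (hY : ∀ s k, Measurable (Y s k))
    {φ : ℕ → Ω → Bool} (hφ : IsSwitchingRule Y φ) (k : ℕ) : Measurable (φ k) := by
  induction k using Nat.strong_induction_on with
  | _ k ih =>
    refine (hφ k).mono (iSup₂_le fun i hi => ?_) le_rfl
    have hik := (Finset.mem_Icc.1 hi).2
    by_cases hk : i ≤ k
    · exact (measurable_scanObs_of hY fun l hl => ih l (lt_of_lt_of_le hl hk)).comap_le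
    · exact absurd hik hk

theorem measurable_scanObs {Y : ℕ → ℕ → Ω → ℝ} (hY : ∀ s k, Measurable (Y s k))
    {φ : ℕ → Ω → Bool} (hφ : IsSwitchingRule Y φ) (k : ℕ) : Measurable (scanObs Y φ k) :=
  measurable_scanObs_of hY fun i _ => measurable_rule hY hφ i

/-- The filtration `F_k = σ(Z_1, …, Z_k)` of the scanning stage. -/
def scanFiltration {Y : ℕ → ℕ → Ω → ℝ} (hY : ∀ s k, Measurable (Y s k)) {φ : ℕ → Ω → Bool}
    (hφ : IsSwitchingRule Y φ) : Filtration ℕ mΩ where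
  seq := scanInfo Y φ
  mono' := fun _ _ hkl => biSup_mono fun _ hi => Finset.Icc_subset_Icc_right hkl hi
  le' := fun _ => iSup₂_le fun i _ => (measurable_scanObs hY hφ i).comap_le

end Scan

/-! ### The refinement stage -/

section Refine

variable {Ω : Type*}

/-- The hypotheses of the two candidate sequences `s_{τ₀}¹` and `s_{τ₀}²`. -/
def candidateHyp (θ : ℕ → Ω → Bool) (φ : ℕ → Ω → Bool) (τ₀ : Ω → ℕ∞) (ω : Ω) : Bool × Bool :=
  (θ (2 * pairIndex φ (τ₀ ω).toNat ω) ω, θ (2 * pairIndex φ (τ₀ ω).toNat ω + 1) ω)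

/-- The refinement observation `X_j`: the sample of the first candidate at slot `τ₀ + j`. -/
def refineObs (Y : ℕ → ℕ → Ω → ℝ) (φ : ℕ → Ω → Bool) (τ₀ : Ω → ℕ∞) (j : ℕ) (ω : Ω) : ℝ :=
  Y (2 * pairIndex φ (τ₀ ω).toNat ω) ((τ₀ ω).toNat + j) ω

variable [mΩ : MeasurableSpace Ω]

theorem measurable_refineObs {Y : ℕ → ℕ → Ω → ℝ} (hY : ∀ s k, Measurable (Y s k))
    {φ : ℕ → Ω → Bool} (hφ : IsSwitchingRule Y φ) {τ₀ : Ω → ℕ∞}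
    (hτ₀ : IsStoppingTime (scanFiltration hY hφ) τ₀) (j : ℕ) :
    Measurable (refineObs Y φ τ₀ j) := by
  have hτ : Measurable fun ω => (τ₀ ω).toNat :=
    (measurable_from_top (f := ENat.toNat)).comp (measurable_to_countable' fun n => by
      cases n with
      | top =>
        have : τ₀ ⁻¹' {⊤} = ⋂ i : ℕ, {ω | τ₀ ω ≤ (i : ℕ∞)}ᶜ := by
          ext ω
          simp only [Set.mem_preimage, Set.mem_singleton_iff, Set.mem_iInter, Set.mem_compl_iff,
            Set.mem_ofPred_eq, not_le]
          exact ENat.eq_top_iff_forall_gt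
        rw [this]
        exact MeasurableSet.iInter fun i => ((scanFiltration hY hφ).le i _ (hτ₀ i)).compl
      | coe i => exact (scanFiltration hY hφ).le i _ (hτ₀.measurableSet_eq i))
  have hp : Measurable fun ω => pairIndex φ (τ₀ ω).toNat ω := by
    have h : Measurable fun p : ℕ × Ω => pairIndex φ p.1 p.2 :=
      measurable_from_prod_countable_right fun q =>
        measurable_pairIndex fun i _ => measurable_rule hY hφ i
    exact h.comp (hτ.prodMk measurable_id)
  exact measurable_select hY (hp.const_mul 2) (hτ.add_const j)

/-- The filtration `G_j = σ(Z_1, …, Z_{τ₀}, X_1, …, X_j)` of the refinement stage, where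
`σ(Z_1, …, Z_{τ₀}) = F_{τ₀}`. -/
def refineFiltration {Y : ℕ → ℕ → Ω → ℝ} (hY : ∀ s k, Measurable (Y s k))
    {φ : ℕ → Ω → Bool} (hφ : IsSwitchingRule Y φ) {τ₀ : Ω → ℕ∞}
    (hτ₀ : IsStoppingTime (scanFiltration hY hφ) τ₀) : Filtration ℕ mΩ where
  seq := fun j => hτ₀.measurableSpace ⊔
    ⨆ i ∈ Finset.Icc 1 j, MeasurableSpace.comap (refineObs Y φ τ₀ i) inferInstance
  mono' := fun _ _ hkl =>
    sup_le_sup_left (biSup_mono fun _ hi => Finset.Icc_subset_Icc_right hkl hi) _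
  le' := fun _ => sup_le hτ₀.measurableSpace_le
    (iSup₂_le fun i _ => (measurable_refineObs hY hφ hτ₀ i).comap_le)

/-- The posterior vector `r_j`; its entry at `(a, b)` is the conditional probability, given `G_j`,
that the hypotheses of the two candidates are `a` and `b`. -/
def posteriorVec (μ : Measure Ω) (θ : ℕ → Ω → Bool) {Y : ℕ → ℕ → Ω → ℝ}
    (hY : ∀ s k, Measurable (Y s k)) {φ : ℕ → Ω → Bool} (hφ : IsSwitchingRule Y φ)
    {τ₀ : Ω → ℕ∞} (hτ₀ : IsStoppingTime (scanFiltration hY hφ) τ₀) (j : ℕ) (ω : Ω) :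
    Bool × Bool → ℝ := fun h =>
  (μ[({ω' | candidateHyp θ φ τ₀ ω' = h}).indicator (fun _ => (1 : ℝ)) |
    refineFiltration hY hφ hτ₀ j]) ω

end Refine

/-! ### The refinement cost and the Bellman equation -/

/-- `q₁ = r^{1,1} + r^{1,0}`. -/
def q₁ (r : Bool × Bool → ℝ) : ℝ := r (true, true) + r (true, false)

/-- `q₂ = r^{1,1} + r^{0,1}`. -/
def q₂ (r : Bool × Bool → ℝ) : ℝ := r (true, true) + r (false, true)

/-- The cost `1 - max {q₁, q₂}` of stopping at the posterior vector `r`. -/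
def stopCost (r : Bool × Bool → ℝ) : ℝ := 1 - max (q₁ r) (q₂ r)

/-- The density at `x` of the next observation of the first candidate, at posterior vector `r`. -/
def nextDensity (f₀ f₁ : ℝ → ℝ) (r : Bool × Bool → ℝ) (x : ℝ) : ℝ :=
  f₁ x * (r (true, true) + r (true, false)) + f₀ x * (r (false, true) + r (false, false))

/-- Bayes' rule: the posterior vector after one more observation `x` of the first candidate. -/
def bayes (f₀ f₁ : ℝ → ℝ) (r : Bool × Bool → ℝ) (x : ℝ) : Bool × Bool → ℝ := fun h =>
  (if h.1 then f₁ x else f₀ x) * r h / nextDensity f₀ f₁ r x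

/-- `E[V(r_{j+1}) | r_j = r]`. -/
def expectNext (f₀ f₁ : ℝ → ℝ) (V : (Bool × Bool → ℝ) → ℝ) (r : Bool × Bool → ℝ) : ℝ :=
  ∫ x, V (bayes f₀ f₁ r x) * nextDensity f₀ f₁ r x

/-- `V` is a bounded measurable solution of the Bellman equation on the probability simplex. -/
structure IsBellmanSolution (f₀ f₁ : ℝ → ℝ) (c : ℝ) (V : (Bool × Bool → ℝ) → ℝ) : Prop where
  measurable : Measurable V
  bounded : ∃ M : ℝ, ∀ r ∈ stdSimplex ℝ (Bool × Bool), |V r| ≤ M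
  bellman : ∀ r ∈ stdSimplex ℝ (Bool × Bool),
    V r = min (stopCost r) (c + expectNext f₀ f₁ V r)

/-- The cost `c τ₁ + 1 - max {q_{1,τ₁}, q_{2,τ₁}}` along the process `r`; it is `∞` where
`τ₁ = ∞` (for `c > 0`). -/
def refineCost {Ω : Type*} (c : ℝ) (r : ℕ → Ω → Bool × Bool → ℝ) (τ₁ : Ω → ℕ∞) (ω : Ω) : ℝ≥0∞ :=
  ENNReal.ofReal c * (τ₁ ω : ℝ≥0∞) + ENNReal.ofReal (stopCost (r (τ₁ ω).toNat ω))

/-- The first `j ≥ 0` with `1 - max {q_{1,j}, q_{2,j}} ≤ c + E[V(r_{j+1}) | r_j]`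
(`∞` if there is none). -/
def firstStop {Ω : Type*} (f₀ f₁ : ℝ → ℝ) (c : ℝ) (V : (Bool × Bool → ℝ) → ℝ)
    (r : ℕ → Ω → Bool × Bool → ℝ) (ω : Ω) : ℕ∞ :=
  ⨅ (j : ℕ) (_ : stopCost (r j ω) ≤ c + expectNext f₀ f₁ V (r j ω)), (j : ℕ∞)

/-- `v` is the `μ`-essential infimum of the family `C`, taken in its `m`-measurable version. -/
structure IsEssInf {Ω : Type*} [mΩ : MeasurableSpace Ω] (μ : Measure Ω) (m : MeasurableSpace Ω)
    (C : Set (Ω → ℝ≥0∞)) (v : Ω → ℝ≥0∞) : Prop where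
  measurable : Measurable[m] v
  le : ∀ g ∈ C, v ≤ᵐ[μ] g
  greatest : ∀ u : Ω → ℝ≥0∞, Measurable[mΩ] u → (∀ g ∈ C, u ≤ᵐ[μ] g) → u ≤ᵐ[μ] v

/-- The family of conditional refinement costs `E[c τ₁ + 1 - max {q_{1,τ₁}, q_{2,τ₁}} | F_{τ₀}]`,
over all stopping times `τ₁` of the filtration `G`. The essential infimum of this family is
the refinement cost `v(τ₀, φ)`. -/
def condCosts {Ω : Type*} [mΩ : MeasurableSpace Ω] (c : ℝ) (μ : Measure Ω)
    (F : MeasurableSpace Ω) (G : Filtration ℕ mΩ) (r : ℕ → Ω → Bool × Bool → ℝ) :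
    Set (Ω → ℝ≥0∞) :=
  {g | ∃ τ₁ : Ω → ℕ∞, IsStoppingTime G τ₁ ∧ g = μ⁻[refineCost c r τ₁ | F]}

end MixedSearch

end

open MixedSearch

namespace MixedSearch

/-! ### One step of the Bellman recursion -/

section Deterministic

variable {f₀ f₁ : ℝ → ℝ}

/-! The proof is a verification argument. It shows that the posterior vector is a Markov process
with the Bayes kernel, and then that the value along it, plus the sampling cost already paid, is a
submartingale which becomes a martingale up to the first time stopping is at least as good as
continuing.

The Markov property starts from `IsSearchModel.isNextObs`: given the hypotheses of both candidates
and the past, the next refinement sample has the density belonging to the first candidate's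
hypothesis. Random times and indices are removed by splitting into the countably many events on
which `τ₀` and the pair index are constant; on each, `IsSearchModel.measure_past_inter_sample` uses
independence of the sequences and of the samples within one. Averaging over the hypotheses
(`lintegral_nextObs`) gives the predictive density, `posterior_eq_bayes` the update, and
`setLIntegral_posterior_next` the one-step expectation.

Optimality is then abstract. By `le_setLIntegral_cost` no stopping time beats the value: stopping at
`τ ∧ n` costs at least the initial value, and the error left at `n` vanishes because the value is at
most one and never stopping costs infinity. By `setLIntegral_cost_le` the first stopping time
attains it, via Fatou. Both are proved on every event of the initial σ-algebra, hence give
conditional statements. Existence of a solution comes from monotone value iteration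
(`exists_isBellmanSolution`). No uniqueness theorem is needed, since the verification applies to
each bounded solution. -/

theorem IsPDF.integrable {f : ℝ → ℝ} (hf : IsPDF f) : Integrable f := by
  refine ⟨hf.measurable.aestronglyMeasurable, ?_⟩
  rw [hasFiniteIntegral_iff_ofReal (ae_of_all _ hf.nonneg), hf.lintegral_eq_one]
  exact ENNReal.one_lt_top

theorem IsPDF.integral_eq_one {f : ℝ → ℝ} (hf : IsPDF f) : ∫ x, f x = 1 := by
  rw [integral_eq_lintegral_of_nonneg_ae (ae_of_all _ hf.nonneg)
    hf.measurable.aestronglyMeasurable, hf.lintegral_eq_one, ENNReal.toReal_one]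

theorem IsPDF.isProbabilityMeasure {f : ℝ → ℝ} (hf : IsPDF f) :
    IsProbabilityMeasure (pdfMeasure f) :=
  ⟨by rw [pdfMeasure, withDensity_apply _ MeasurableSet.univ, setLIntegral_univ,
    hf.lintegral_eq_one]⟩

theorem sum_eq_one_of_mem_stdSimplex {r : Bool × Bool → ℝ}
    (hr : r ∈ stdSimplex ℝ (Bool × Bool)) :
    r (true, true) + r (true, false) + (r (false, true) + r (false, false)) = 1 := by
  have h := hr.2
  simpa [Fintype.sum_prod_type, add_assoc] using h

theorem stopCost_nonneg {r : Bool × Bool → ℝ} (hr : r ∈ stdSimplex ℝ (Bool × Bool)) :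
    0 ≤ stopCost r := by
  have h := sum_eq_one_of_mem_stdSimplex hr
  have h1 := hr.1 (true, false)
  have h2 := hr.1 (false, true)
  have h3 := hr.1 (false, false)
  have : max (q₁ r) (q₂ r) ≤ 1 := max_le (by unfold q₁; linarith) (by unfold q₂; linarith)
  unfold stopCost
  linarith

theorem stopCost_le_one {r : Bool × Bool → ℝ} (hr : r ∈ stdSimplex ℝ (Bool × Bool)) :
    stopCost r ≤ 1 := by
  have h0 := hr.1 (true, true)
  have h1 := hr.1 (true, false)
  have : 0 ≤ max (q₁ r) (q₂ r) := le_max_of_le_left (by unfold q₁; linarith)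
  unfold stopCost
  linarith

theorem measurable_stopCost : Measurable stopCost := by
  unfold stopCost q₁ q₂
  fun_prop

theorem measurable_nextDensity (hf₀ : IsPDF f₀) (hf₁ : IsPDF f₁) :
    Measurable fun p : (Bool × Bool → ℝ) × ℝ => nextDensity f₀ f₁ p.1 p.2 := by
  have h0 := hf₀.measurable
  have h1 := hf₁.measurable
  unfold nextDensity
  fun_prop

theorem measurable_bayes (hf₀ : IsPDF f₀) (hf₁ : IsPDF f₁) :
    Measurable fun p : (Bool × Bool → ℝ) × ℝ => bayes f₀ f₁ p.1 p.2 := by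
  have h0 := hf₀.measurable
  have h1 := hf₁.measurable
  have h2 := measurable_nextDensity hf₀ hf₁
  refine measurable_pi_iff.2 fun h => ?_
  unfold bayes
  rcases h with ⟨_ | _, b⟩ <;> simp only [Bool.false_eq_true, if_true, if_false] <;> fun_prop

theorem measurable_expectNext (hf₀ : IsPDF f₀) (hf₁ : IsPDF f₁) {V : (Bool × Bool → ℝ) → ℝ}
    (hV : Measurable V) : Measurable (expectNext f₀ f₁ V) :=
  (StronglyMeasurable.integral_prod_right (f := fun (r : Bool × Bool → ℝ) (x : ℝ) =>
    V (bayes f₀ f₁ r x) * nextDensity f₀ f₁ r x)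
    (((hV.comp (measurable_bayes hf₀ hf₁)).mul
      (measurable_nextDensity hf₀ hf₁)).stronglyMeasurable)).measurable

variable {r : Bool × Bool → ℝ}

theorem nextDensity_nonneg (hf₀ : IsPDF f₀) (hf₁ : IsPDF f₁)
    (hr : r ∈ stdSimplex ℝ (Bool × Bool)) (x : ℝ) : 0 ≤ nextDensity f₀ f₁ r x :=
  add_nonneg (mul_nonneg (hf₁.nonneg x) (add_nonneg (hr.1 _) (hr.1 _)))
    (mul_nonneg (hf₀.nonneg x) (add_nonneg (hr.1 _) (hr.1 _)))

theorem integrable_nextDensity (hf₀ : IsPDF f₀) (hf₁ : IsPDF f₁) (r : Bool × Bool → ℝ) :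
    Integrable (nextDensity f₀ f₁ r) :=
  (hf₁.integrable.mul_const _).add (hf₀.integrable.mul_const _)

theorem integral_nextDensity (hf₀ : IsPDF f₀) (hf₁ : IsPDF f₁)
    (hr : r ∈ stdSimplex ℝ (Bool × Bool)) : ∫ x, nextDensity f₀ f₁ r x = 1 := by
  unfold nextDensity
  rw [integral_add (hf₁.integrable.mul_const _) (hf₀.integrable.mul_const _),
    integral_mul_const, integral_mul_const, hf₀.integral_eq_one, hf₁.integral_eq_one, one_mul,
    one_mul, sum_eq_one_of_mem_stdSimplex hr]

theorem bayes_mem_stdSimplex (hf₀ : IsPDF f₀) (hf₁ : IsPDF f₁)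
    (hr : r ∈ stdSimplex ℝ (Bool × Bool)) {x : ℝ} (hx : nextDensity f₀ f₁ r x ≠ 0) :
    bayes f₀ f₁ r x ∈ stdSimplex ℝ (Bool × Bool) := by
  constructor
  · intro h
    refine div_nonneg (mul_nonneg ?_ (hr.1 h)) (nextDensity_nonneg hf₀ hf₁ hr x)
    split_ifs
    exacts [hf₁.nonneg x, hf₀.nonneg x]
  · simp only [bayes]
    rw [← Finset.sum_div, div_eq_one_iff_eq hx]
    simp only [Fintype.sum_prod_type, Fintype.sum_bool, nextDensity, if_true,
      Bool.false_eq_true, if_false]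
    ring

theorem measurable_bayes_right (hf₀ : IsPDF f₀) (hf₁ : IsPDF f₁) (r : Bool × Bool → ℝ) :
    Measurable (bayes f₀ f₁ r) :=
  (measurable_bayes hf₀ hf₁).comp measurable_prodMk_left

/-- Where the predictive density vanishes, `bayes` divides by zero and leaves the simplex, so
nothing is known about `V` there; the vanishing weight makes this harmless. The same case split
recurs below. -/
theorem integrable_expectNext (hf₀ : IsPDF f₀) (hf₁ : IsPDF f₁) {V : (Bool × Bool → ℝ) → ℝ}
    (hV : Measurable V) {M : ℝ} (hM : ∀ r ∈ stdSimplex ℝ (Bool × Bool), |V r| ≤ M)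
    (hr : r ∈ stdSimplex ℝ (Bool × Bool)) :
    Integrable fun x => V (bayes f₀ f₁ r x) * nextDensity f₀ f₁ r x := by
  refine ((integrable_nextDensity hf₀ hf₁ r).const_mul M).mono'
    ((hV.comp (measurable_bayes_right hf₀ hf₁ r)).aestronglyMeasurable.mul
      (integrable_nextDensity hf₀ hf₁ r).aestronglyMeasurable) (ae_of_all _ fun x => ?_)
  have hn := nextDensity_nonneg hf₀ hf₁ hr x
  rw [Real.norm_eq_abs, abs_mul, abs_of_nonneg hn]
  by_cases hx : nextDensity f₀ f₁ r x = 0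
  · simp [hx]
  · exact mul_le_mul_of_nonneg_right (hM _ (bayes_mem_stdSimplex hf₀ hf₁ hr hx)) hn

theorem expectNext_mono (hf₀ : IsPDF f₀) (hf₁ : IsPDF f₁) {V W : (Bool × Bool → ℝ) → ℝ}
    (hV : Measurable V) (hW : Measurable W) {M N : ℝ}
    (hM : ∀ r ∈ stdSimplex ℝ (Bool × Bool), |V r| ≤ M)
    (hN : ∀ r ∈ stdSimplex ℝ (Bool × Bool), |W r| ≤ N)
    (hVW : ∀ r ∈ stdSimplex ℝ (Bool × Bool), V r ≤ W r)
    (hr : r ∈ stdSimplex ℝ (Bool × Bool)) :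
    expectNext f₀ f₁ V r ≤ expectNext f₀ f₁ W r := by
  refine integral_mono (integrable_expectNext hf₀ hf₁ hV hM hr)
    (integrable_expectNext hf₀ hf₁ hW hN hr) fun x => ?_
  by_cases hx : nextDensity f₀ f₁ r x = 0
  · simp [hx]
  · exact mul_le_mul_of_nonneg_right (hVW _ (bayes_mem_stdSimplex hf₀ hf₁ hr hx))
      (nextDensity_nonneg hf₀ hf₁ hr x)

theorem expectNext_const (hf₀ : IsPDF f₀) (hf₁ : IsPDF f₁)
    (hr : r ∈ stdSimplex ℝ (Bool × Bool)) (a : ℝ) : expectNext f₀ f₁ (fun _ => a) r = a := by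
  rw [expectNext, integral_const_mul, integral_nextDensity hf₀ hf₁ hr, mul_one]

theorem ofReal_expectNext (hf₀ : IsPDF f₀) (hf₁ : IsPDF f₁) {V : (Bool × Bool → ℝ) → ℝ}
    (hV : Measurable V) {M : ℝ} (hM : ∀ r ∈ stdSimplex ℝ (Bool × Bool), |V r| ≤ M)
    (h0 : ∀ r ∈ stdSimplex ℝ (Bool × Bool), 0 ≤ V r) (hr : r ∈ stdSimplex ℝ (Bool × Bool)) :
    ENNReal.ofReal (expectNext f₀ f₁ V r) = ∫⁻ x, ENNReal.ofReal (nextDensity f₀ f₁ r x) *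
      ENNReal.ofReal (V (bayes f₀ f₁ r x)) := by
  have hn := nextDensity_nonneg hf₀ hf₁ hr
  rw [expectNext, ofReal_integral_eq_lintegral_ofReal
    (integrable_expectNext hf₀ hf₁ hV hM hr)]
  · refine lintegral_congr fun x => ?_
    rw [mul_comm, ENNReal.ofReal_mul (hn x)]
  · refine ae_of_all _ fun x => ?_
    by_cases hx : nextDensity f₀ f₁ r x = 0
    · simp [hx]
    · exact mul_nonneg (h0 _ (bayes_mem_stdSimplex hf₀ hf₁ hr hx)) (hn x)

variable {c : ℝ} {V : (Bool × Bool → ℝ) → ℝ}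

theorem IsBellmanSolution.le_stopCost (hV : IsBellmanSolution f₀ f₁ c V)
    (hr : r ∈ stdSimplex ℝ (Bool × Bool)) : V r ≤ stopCost r :=
  (hV.bellman r hr).trans_le (min_le_left _ _)

/-- The equation itself forces the sign: the stopping branch is nonnegative, and each pass through
the continuation branch raises a negative lower bound by `c > 0`. Consequently the later integrals
can be taken in `ℝ≥0∞`. -/
theorem IsBellmanSolution.nonneg (hf₀ : IsPDF f₀) (hf₁ : IsPDF f₁) (hc : 0 < c)
    (hV : IsBellmanSolution f₀ f₁ c V) (hr : r ∈ stdSimplex ℝ (Bool × Bool)) : 0 ≤ V r := by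
  obtain ⟨M, hM⟩ := hV.bounded
  -- a lower bound `-a` improves to `min 0 (c - a)`
  have key : ∀ n : ℕ, ∀ r ∈ stdSimplex ℝ (Bool × Bool), min 0 (-M + n * c) ≤ V r := by
    intro n
    induction n with
    | zero => exact fun r hr => min_le_of_right_le (by simpa using (abs_le.1 (hM r hr)).1)
    | succ n ih =>
      intro r hr
      rw [hV.bellman r hr]
      refine le_min (min_le_of_left_le (stopCost_nonneg hr)) ?_
      have h := expectNext_mono hf₀ hf₁ (W := V) measurable_const hV.measurable
        (fun _ _ => le_rfl) hM ih hr
      rw [expectNext_const hf₀ hf₁ hr] at h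
      refine le_trans ?_ (add_le_add_right h c)
      rw [← min_add_add_left]
      refine min_le_min (by linarith) (le_of_eq ?_)
      push_cast
      ring
  -- After this many rounds `-M + n * c` is positive, so the lower bound is `0`.
  obtain ⟨n, hn⟩ := exists_nat_gt (M / c)
  rw [div_lt_iff₀ hc] at hn
  exact (le_min le_rfl (by linarith)).trans (key n r hr)

theorem IsBellmanSolution.abs_le_one (hf₀ : IsPDF f₀) (hf₁ : IsPDF f₁) (hc : 0 < c)
    (hV : IsBellmanSolution f₀ f₁ c V) (r : Bool × Bool → ℝ)
    (hr : r ∈ stdSimplex ℝ (Bool × Bool)) : |V r| ≤ 1 := by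
  rw [abs_of_nonneg (hV.nonneg hf₀ hf₁ hc hr)]
  exact (hV.le_stopCost hr).trans (stopCost_le_one hr)

theorem IsBellmanSolution.expectNext_nonneg (hf₀ : IsPDF f₀) (hf₁ : IsPDF f₁) (hc : 0 < c)
    (hV : IsBellmanSolution f₀ f₁ c V) (hr : r ∈ stdSimplex ℝ (Bool × Bool)) :
    0 ≤ expectNext f₀ f₁ V r := by
  have h := expectNext_mono hf₀ hf₁ (measurable_const (a := (0 : ℝ))) hV.measurable
    (fun _ _ => abs_zero.le) (hV.abs_le_one hf₀ hf₁ hc)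
    (fun _ hr => hV.nonneg hf₀ hf₁ hc hr) hr
  rwa [expectNext_const hf₀ hf₁ hr] at h

theorem IsBellmanSolution.abs_expectNext_le_one (hf₀ : IsPDF f₀) (hf₁ : IsPDF f₁) (hc : 0 < c)
    (hV : IsBellmanSolution f₀ f₁ c V) (r : Bool × Bool → ℝ)
    (hr : r ∈ stdSimplex ℝ (Bool × Bool)) : |expectNext f₀ f₁ V r| ≤ 1 := by
  have h := expectNext_mono hf₀ hf₁ hV.measurable (measurable_const (a := (1 : ℝ)))
    (hV.abs_le_one hf₀ hf₁ hc) (fun _ _ => abs_one.le)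
    (fun r hr => (le_abs_self _).trans (hV.abs_le_one hf₀ hf₁ hc r hr)) hr
  rw [expectNext_const hf₀ hf₁ hr] at h
  rwa [abs_of_nonneg (hV.expectNext_nonneg hf₀ hf₁ hc hr)]

/-- Value iteration, started at `0`. -/
noncomputable def valueIter (f₀ f₁ : ℝ → ℝ) (c : ℝ) : ℕ → (Bool × Bool → ℝ) → ℝ
  | 0 => fun _ => 0
  | n + 1 => fun r => min (stopCost r) (c + expectNext f₀ f₁ (valueIter f₀ f₁ c n) r)

theorem measurable_valueIter (hf₀ : IsPDF f₀) (hf₁ : IsPDF f₁) (n : ℕ) :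
    Measurable (valueIter f₀ f₁ c n) := by
  induction n with
  | zero => exact measurable_const
  | succ n ih =>
    exact measurable_stopCost.min ((measurable_expectNext hf₀ hf₁ ih).const_add c)

theorem valueIter_nonneg (hf₀ : IsPDF f₀) (hf₁ : IsPDF f₁) (hc : 0 < c) (n : ℕ) :
    ∀ r ∈ stdSimplex ℝ (Bool × Bool), 0 ≤ valueIter f₀ f₁ c n r := by
  induction n with
  | zero => exact fun _ _ => le_rfl
  | succ n ih =>
    refine fun r hr => le_min (stopCost_nonneg hr) (add_nonneg hc.le (integral_nonneg fun x => ?_))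
    by_cases hx : nextDensity f₀ f₁ r x = 0
    · simp [hx]
    · exact mul_nonneg (ih _ (bayes_mem_stdSimplex hf₀ hf₁ hr hx))
        (nextDensity_nonneg hf₀ hf₁ hr x)

theorem abs_valueIter_le_one (hf₀ : IsPDF f₀) (hf₁ : IsPDF f₁) (hc : 0 < c) (n : ℕ) :
    ∀ r ∈ stdSimplex ℝ (Bool × Bool), |valueIter f₀ f₁ c n r| ≤ 1 := by
  intro r hr
  rw [abs_of_nonneg (valueIter_nonneg hf₀ hf₁ hc n r hr)]
  cases n with
  | zero => exact zero_le_one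
  | succ n => exact (min_le_left _ _).trans (stopCost_le_one hr)

theorem valueIter_le_succ (hf₀ : IsPDF f₀) (hf₁ : IsPDF f₁) (hc : 0 < c) (n : ℕ) :
    ∀ r ∈ stdSimplex ℝ (Bool × Bool), valueIter f₀ f₁ c n r ≤ valueIter f₀ f₁ c (n + 1) r := by
  induction n with
  | zero => exact valueIter_nonneg hf₀ hf₁ hc 1
  | succ n ih =>
    exact fun r hr => min_le_min le_rfl (add_le_add_right (expectNext_mono hf₀ hf₁
      (measurable_valueIter hf₀ hf₁ _) (measurable_valueIter hf₀ hf₁ _)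
      (abs_valueIter_le_one hf₀ hf₁ hc _) (abs_valueIter_le_one hf₀ hf₁ hc _) ih hr) c)

/-- On the simplex, value iteration from `0` increases and stays below `1`, so it converges to its
supremum. Off the simplex the supremum may be a junk value, but only measurability is required
there. -/
theorem exists_isBellmanSolution (hf₀ : IsPDF f₀) (hf₁ : IsPDF f₁) (hc : 0 < c) :
    ∃ V : (Bool × Bool → ℝ) → ℝ, IsBellmanSolution f₀ f₁ c V := by
  have hlim : ∀ r ∈ stdSimplex ℝ (Bool × Bool), Filter.Tendsto
      (fun n => valueIter f₀ f₁ c n r) Filter.atTop (nhds (⨆ n, valueIter f₀ f₁ c n r)) :=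
    fun r hr => tendsto_atTop_ciSup
      (monotone_nat_of_le_succ fun n => valueIter_le_succ hf₀ hf₁ hc n r hr)
      ⟨1, Set.forall_mem_range.2 fun n => (abs_le.1 (abs_valueIter_le_one hf₀ hf₁ hc n r hr)).2⟩
  refine ⟨fun r => ⨆ n, valueIter f₀ f₁ c n r, Measurable.iSup fun n =>
    measurable_valueIter hf₀ hf₁ n, ⟨1, fun r hr => ?_⟩, fun r hr => ?_⟩
  · exact le_of_tendsto' (hlim r hr).abs fun n => abs_valueIter_le_one hf₀ hf₁ hc n r hr
  · refine tendsto_nhds_unique ((Filter.tendsto_add_atTop_iff_nat 1).2 (hlim r hr)) ?_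
    -- The limit passes through the integral by dominated convergence; the iterates are at most `1`
    -- in absolute value, so the predictive density itself dominates.
    refine tendsto_const_nhds.min (tendsto_const_nhds.add ?_)
    have hn := nextDensity_nonneg hf₀ hf₁ hr
    refine tendsto_integral_of_dominated_convergence (nextDensity f₀ f₁ r)
      (fun n => (integrable_expectNext hf₀ hf₁ (measurable_valueIter hf₀ hf₁ n)
        (abs_valueIter_le_one hf₀ hf₁ hc n) hr).aestronglyMeasurable)
      (integrable_nextDensity hf₀ hf₁ r) (fun n => ae_of_all _ fun x => ?_)
      (ae_of_all _ fun x => ?_)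
    · rw [Real.norm_eq_abs, abs_mul, abs_of_nonneg (hn x)]
      by_cases hx : nextDensity f₀ f₁ r x = 0
      · simp [hx]
      · exact mul_le_of_le_one_left (hn x)
          (abs_valueIter_le_one hf₀ hf₁ hc n _ (bayes_mem_stdSimplex hf₀ hf₁ hr hx))
    · by_cases hx : nextDensity f₀ f₁ r x = 0
      · simp [hx]
      · exact (hlim _ (bayes_mem_stdSimplex hf₀ hf₁ hr hx)).mul_const _

end Deterministic

/-! ### Bayesian updating along a σ-algebra -/

section Posterior

variable {Ω : Type*} {m m' : MeasurableSpace Ω} [mΩ : MeasurableSpace Ω]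

/-- Two measures that agree on all intersections of members of two σ-algebras agree on the
σ-algebra generated by both. -/
theorem measure_eq_of_inter_eq {m₁ m₂ : MeasurableSpace Ω} (h₁ : m₁ ≤ mΩ) (h₂ : m₂ ≤ mΩ)
    {ν₁ ν₂ : Measure[mΩ] Ω} [IsFiniteMeasure ν₂]
    (h : ∀ s t, MeasurableSet[m₁] s → MeasurableSet[m₂] t → ν₁ (s ∩ t) = ν₂ (s ∩ t))
    {A : Set Ω} (hA : MeasurableSet[m₁ ⊔ m₂] A) : ν₁ A = ν₂ A := by
  have huniv : ν₁ Set.univ = ν₂ Set.univ := by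
    simpa using h Set.univ Set.univ MeasurableSet.univ MeasurableSet.univ
  have hle : m₁ ⊔ m₂ ≤ mΩ := sup_le h₁ h₂
  have : IsFiniteMeasure ν₁ := ⟨huniv ▸ measure_lt_top ν₂ _⟩
  have hgen : m₁ ⊔ m₂ = MeasurableSpace.generateFrom
      (Set.image2 (· ∩ ·) {s | MeasurableSet[m₁] s} {t | MeasurableSet[m₂] t}) := by
    refine le_antisymm (sup_le (fun s hs => ?_) fun t ht => ?_)
      (MeasurableSpace.generateFrom_le ?_)
    · exact MeasurableSpace.measurableSet_generateFrom
        ⟨s, hs, Set.univ, MeasurableSet.univ, Set.inter_univ s⟩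
    · exact MeasurableSpace.measurableSet_generateFrom
        ⟨Set.univ, MeasurableSet.univ, t, ht, Set.univ_inter t⟩
    · rintro _ ⟨s, hs, t, ht, rfl⟩
      exact MeasurableSet.inter ((le_sup_left : m₁ ≤ m₁ ⊔ m₂) s hs)
        ((le_sup_right : m₂ ≤ m₁ ⊔ m₂) t ht)
  induction A, hA using MeasurableSpace.induction_on_inter hgen with
  | h_inter =>
    rintro _ ⟨s, hs, t, ht, rfl⟩ _ ⟨s', hs', t', ht', rfl⟩ -
    exact ⟨s ∩ s', hs.inter hs', t ∩ t', ht.inter ht', Set.inter_inter_inter_comm _ _ _ _⟩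
  | empty => simp
  | basic A hA =>
    obtain ⟨s, hs, t, ht, rfl⟩ := hA
    exact h s t hs ht
  | compl A hA ih =>
    have hA' : MeasurableSet[mΩ] A := hle A hA
    rw [measure_compl (μ := ν₁) hA' (measure_ne_top _ _),
      measure_compl (μ := ν₂) hA' (measure_ne_top _ _), ih, huniv]
  | iUnion f hd hf ih =>
    have hf' : ∀ i, MeasurableSet[mΩ] (f i) := fun i => hle _ (hf i)
    rw [measure_iUnion (μ := ν₁) hd hf', measure_iUnion (μ := ν₂) hd hf']
    exact tsum_congr ih

/-- The vector of conditional probabilities, given `m`, of the values of `hyp`. -/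
noncomputable def posterior (μ : Measure Ω) (hyp : Ω → Bool × Bool) (m : MeasurableSpace Ω)
    (ω : Ω) : Bool × Bool → ℝ :=
  fun h => (μ[({ω' | hyp ω' = h}).indicator (fun _ => (1 : ℝ)) | m]) ω

variable {μ : Measure Ω} {hyp : Ω → Bool × Bool}

theorem measurable_posterior_apply (h : Bool × Bool) :
    Measurable[m] fun ω => posterior μ hyp m ω h :=
  stronglyMeasurable_condExp.measurable

theorem measurable_posterior : Measurable[m] (posterior μ hyp m) :=
  @measurable_pi_lambda _ _ _ m _ _ measurable_posterior_apply

theorem lintegral_eq_sum_hyp (hhyp : Measurable hyp) (g : Ω → ℝ≥0∞) :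
    ∫⁻ ω, g ω ∂μ = ∑ h, ∫⁻ ω in {ω | hyp ω = h}, g ω ∂μ := by
  rw [← setLIntegral_univ, ← lintegral_finsetSum_measure]
  congr 1
  rw [← Measure.sum_fintype, ← Measure.restrict_iUnion (s := fun h => {ω | hyp ω = h})
    (fun i j hij => ?_) fun h => hhyp (measurableSet_singleton h)]
  · congr 1
    ext ω
    simp
  · exact Set.disjoint_left.2 fun ω h1 h2 => hij (h1.symm.trans h2)

variable [IsProbabilityMeasure μ]

theorem integrable_indicator_hyp (hhyp : Measurable hyp) (h : Bool × Bool) :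
    Integrable (({ω' | hyp ω' = h}).indicator (fun _ => (1 : ℝ))) μ :=
  (integrable_const 1).indicator (hhyp (measurableSet_singleton h))

theorem posterior_mem_stdSimplex (hm : m ≤ mΩ) (hhyp : Measurable hyp) :
    ∀ᵐ ω ∂μ, posterior μ hyp m ω ∈ stdSimplex ℝ (Bool × Bool) := by
  have hpos : ∀ᵐ ω ∂μ, ∀ h, 0 ≤ posterior μ hyp m ω h := ae_all_iff.2 fun h =>
    condExp_nonneg (ae_of_all _ fun ω => Set.indicator_nonneg (fun _ _ => zero_le_one) ω)
  have hsum := condExp_finsetSum (s := Finset.univ)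
    (fun h _ => integrable_indicator_hyp (μ := μ) hhyp h) m
  have hone : (∑ h : Bool × Bool, ({ω' | hyp ω' = h}).indicator (fun _ => (1 : ℝ))) =
      fun _ => (1 : ℝ) := by
    ext ω
    simp [Finset.sum_apply, Set.indicator_apply]
  rw [hone, condExp_const hm] at hsum
  filter_upwards [hpos, hsum] with ω h1 h2
  refine ⟨h1, ?_⟩
  rw [Finset.sum_apply] at h2
  exact h2.symm

theorem setLIntegral_posterior (hm : m ≤ mΩ) (hhyp : Measurable hyp) (h : Bool × Bool)
    {A : Set Ω} (hA : MeasurableSet[m] A) :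
    ∫⁻ ω in A, ENNReal.ofReal (posterior μ hyp m ω h) ∂μ = μ ({ω | hyp ω = h} ∩ A) := by
  have hpos : ∀ᵐ ω ∂μ.restrict A, 0 ≤ posterior μ hyp m ω h := by
    filter_upwards [ae_restrict_of_ae (posterior_mem_stdSimplex hm hhyp)] with ω hω
    exact hω.1 h
  rw [← ofReal_integral_eq_lintegral_ofReal (f := fun ω => posterior μ hyp m ω h)
    (Integrable.integrableOn (integrable_condExp (m := m) (μ := μ))) hpos]
  change ENNReal.ofReal
    (∫ ω in A, (μ[({ω' | hyp ω' = h}).indicator (fun _ => (1 : ℝ)) | m]) ω ∂μ) = _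
  rw [setIntegral_condExp hm (integrable_indicator_hyp hhyp h) hA]
  have hS : MeasurableSet {ω | hyp ω = h} := hhyp (measurableSet_singleton h)
  rw [integral_indicator_const _ hS, smul_eq_mul, mul_one, measureReal_def,
    ENNReal.ofReal_toReal (measure_ne_top _ _), Measure.restrict_apply hS]

variable {α : Type*} [MeasurableSpace α] {U : Ω → α}

/-- Events defined by `U` lie in `m`, so on them the event `hyp = h` may be replaced by its
conditional probability, used as a density. -/
theorem map_restrict_hyp (hm : m ≤ mΩ) (hhyp : Measurable hyp) (hU : Measurable[m] U)
    (h : Bool × Bool) :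
    (μ.restrict {ω | hyp ω = h}).map U =
      (μ.withDensity fun ω => ENNReal.ofReal (posterior μ hyp m ω h)).map U := by
  have hU' : Measurable U := hU.mono hm le_rfl
  ext s hs
  rw [Measure.map_apply hU' hs, Measure.map_apply hU' hs, withDensity_apply _ (hU' hs),
    setLIntegral_posterior hm hhyp h (hU hs), Measure.restrict_apply (hU' hs), Set.inter_comm]

variable {f₀ f₁ : ℝ → ℝ} {X : Ω → ℝ}

/-- Given the hypotheses and the past `m`, the next observation `X` of the first candidate has the
density that belongs to its hypothesis. -/
structure IsNextObs (f₀ f₁ : ℝ → ℝ) (μ : Measure Ω) (hyp : Ω → Bool × Bool)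
    (m : MeasurableSpace Ω) (X : Ω → ℝ) : Prop where
  measurable : Measurable[mΩ] X
  measure_inter : ∀ (A : Set Ω), MeasurableSet[m] A → ∀ (h : Bool × Bool) (B : Set ℝ),
    MeasurableSet B → μ (A ∩ {ω | hyp ω = h} ∩ X ⁻¹' B) =
      μ (A ∩ {ω | hyp ω = h}) * pdfMeasure (if h.1 then f₁ else f₀) B

theorem isProbabilityMeasure_pdfMeasure_ite (hf₀ : IsPDF f₀) (hf₁ : IsPDF f₁) (b : Bool) :
    IsProbabilityMeasure (pdfMeasure (if b then f₁ else f₀)) := by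
  split_ifs
  exacts [hf₁.isProbabilityMeasure, hf₀.isProbabilityMeasure]

theorem measurable_ite_density (hf₀ : IsPDF f₀) (hf₁ : IsPDF f₁) (b : Bool) :
    Measurable (if b then f₁ else f₀) := by
  split_ifs
  exacts [hf₁.measurable, hf₀.measurable]

theorem ite_density_nonneg (hf₀ : IsPDF f₀) (hf₁ : IsPDF f₁) (b : Bool) (x : ℝ) :
    0 ≤ (if b then f₁ else f₀) x := by
  split_ifs
  exacts [hf₁.nonneg x, hf₀.nonneg x]

/-- With the hypotheses fixed, `IsNextObs` makes the joint law of `U` and `X` a product. Tonelli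
integrates out `X`, and `map_restrict_hyp` turns the remaining restriction into a posterior weight.
-/
theorem setLIntegral_hyp_nextObs (hf₀ : IsPDF f₀) (hf₁ : IsPDF f₁) (hm : m ≤ mΩ)
    (hhyp : Measurable hyp) (hX : IsNextObs f₀ f₁ μ hyp m X) (hU : Measurable[m] U)
    {g : α × ℝ → ℝ≥0∞} (hg : Measurable g) (h : Bool × Bool) :
    ∫⁻ ω in {ω | hyp ω = h}, g (U ω, X ω) ∂μ =
      ∫⁻ ω, ENNReal.ofReal (posterior μ hyp m ω h) *
        (∫⁻ x, ENNReal.ofReal ((if h.1 then f₁ else f₀) x) * g (U ω, x)) ∂μ := by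
  have hU' : Measurable U := hU.mono hm le_rfl
  have hS : MeasurableSet {ω | hyp ω = h} := hhyp (measurableSet_singleton h)
  have := isProbabilityMeasure_pdfMeasure_ite hf₀ hf₁ h.1
  have hd := measurable_ite_density hf₀ hf₁ h.1
  have hprod : (μ.restrict {ω | hyp ω = h}).map (fun ω => (U ω, X ω)) =
      ((μ.restrict {ω | hyp ω = h}).map U).prod (pdfMeasure (if h.1 then f₁ else f₀)) := by
    refine (Measure.prod_eq fun s t hs ht => ?_).symm
    rw [Measure.map_apply (hU'.prodMk hX.measurable) (hs.prod ht), Measure.map_apply hU' hs,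
      Measure.restrict_apply (hU' hs), ← hX.measure_inter _ (hU hs) h t ht,
      Measure.restrict_apply ((hU'.prodMk hX.measurable) (hs.prod ht))]
    congr 1
    ext ω
    simp only [Set.mem_inter_iff, Set.mem_preimage, Set.mem_prod]
    tauto
  have hinner : ∀ u, ∫⁻ x, g (u, x) ∂(pdfMeasure (if h.1 then f₁ else f₀)) =
      ∫⁻ x, ENNReal.ofReal ((if h.1 then f₁ else f₀) x) * g (u, x) := fun u => by
    rw [pdfMeasure, lintegral_withDensity_eq_lintegral_mul _ hd.ennreal_ofReal
      (g := fun x => g (u, x)) (hg.comp measurable_prodMk_left)]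
    rfl
  have hK : Measurable fun u => ∫⁻ x, ENNReal.ofReal ((if h.1 then f₁ else f₀) x) * g (u, x) :=
    Measurable.lintegral_prod_right' (f := fun p : α × ℝ =>
      ENNReal.ofReal ((if h.1 then f₁ else f₀) p.2) * g p)
      ((hd.comp measurable_snd).ennreal_ofReal.mul hg)
  rw [← lintegral_map (f := g) hg (hU'.prodMk hX.measurable), hprod, lintegral_prod _
    hg.aemeasurable, lintegral_congr hinner, map_restrict_hyp hm hhyp hU h,
    lintegral_map hK hU', lintegral_withDensity_eq_lintegral_mul (g := fun ω =>
      ∫⁻ x, ENNReal.ofReal ((if h.1 then f₁ else f₀) x) * g (U ω, x)) _ _ (hK.comp hU')]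
  · rfl
  · exact ((measurable_posterior_apply h).mono hm le_rfl).ennreal_ofReal

/-- Summing over the four hypothesis pairs mixes the two densities with the posterior weights, and
that mixture is `nextDensity`: the predictive density of `X` given `m`. -/
theorem lintegral_nextObs (hf₀ : IsPDF f₀) (hf₁ : IsPDF f₁) (hm : m ≤ mΩ)
    (hhyp : Measurable hyp) (hX : IsNextObs f₀ f₁ μ hyp m X) (hU : Measurable[m] U)
    {g : α × ℝ → ℝ≥0∞} (hg : Measurable g) :
    ∫⁻ ω, g (U ω, X ω) ∂μ = ∫⁻ ω, (∫⁻ x,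
      ENNReal.ofReal (nextDensity f₀ f₁ (posterior μ hyp m ω) x) * g (U ω, x)) ∂μ := by
  have hU' : Measurable U := hU.mono hm le_rfl
  have hd := measurable_ite_density hf₀ hf₁
  rw [lintegral_eq_sum_hyp hhyp]
  simp_rw [setLIntegral_hyp_nextObs hf₀ hf₁ hm hhyp hX hU hg]
  rw [← lintegral_finsetSum']
  · refine lintegral_congr_ae ?_
    filter_upwards [posterior_mem_stdSimplex hm hhyp] with ω hr
    have hmeas : ∀ h : Bool × Bool, Measurable fun x =>
        ENNReal.ofReal ((if h.1 then f₁ else f₀) x) * g (U ω, x) := fun h =>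
      (hd h.1).ennreal_ofReal.mul (hg.comp measurable_prodMk_left)
    simp_rw [← lintegral_const_mul _ (hmeas _)]
    rw [← lintegral_finsetSum _ fun h _ => (hmeas h).const_mul _]
    refine lintegral_congr fun x => ?_
    simp_rw [← mul_assoc]
    rw [← Finset.sum_mul]
    congr 1
    simp_rw [← ENNReal.ofReal_mul (hr.1 _)]
    rw [← ENNReal.ofReal_sum_of_nonneg fun h _ =>
      mul_nonneg (hr.1 h) (ite_density_nonneg hf₀ hf₁ h.1 x)]
    congr 1
    simp only [Fintype.sum_prod_type, Fintype.sum_bool, nextDensity, if_true,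
      Bool.false_eq_true, if_false]
    ring
  · intro h _
    refine Measurable.aemeasurable ?_
    refine ((measurable_posterior_apply h).mono hm le_rfl).ennreal_ofReal.mul ?_
    exact (Measurable.lintegral_prod_right' (f := fun p : α × ℝ =>
      ENNReal.ofReal ((if h.1 then f₁ else f₀) p.2) * g p)
      (((hd h.1).comp measurable_snd).ennreal_ofReal.mul hg)).comp hU'

/-- The Bayes vector is `m'`-measurable, so it suffices to compare integrals over events of `m'`,
and by `measure_eq_of_inter_eq` over `s ∩ X ⁻¹' t`. There the predictive density cancels the
denominator of `bayes`. -/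
theorem posterior_eq_bayes (hf₀ : IsPDF f₀) (hf₁ : IsPDF f₁) (hm : m ≤ mΩ)
    (hhyp : Measurable hyp) (hX : IsNextObs f₀ f₁ μ hyp m X)
    (hm' : m' = m ⊔ MeasurableSpace.comap X inferInstance) :
    ∀ᵐ ω ∂μ, posterior μ hyp m' ω = bayes f₀ f₁ (posterior μ hyp m ω) (X ω) := by
  have hXle : MeasurableSpace.comap X inferInstance ≤ mΩ := hX.measurable.comap_le
  have hle : m' ≤ mΩ := hm'.trans_le (sup_le hm hXle)
  have hmm' : m ≤ m' := le_sup_left.trans_eq hm'.symm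
  have hXm' : Measurable[m'] X := Measurable.mono (comap_measurable X)
    (le_sup_right.trans_eq hm'.symm) le_rfl
  have hB : Measurable[m'] fun ω => bayes f₀ f₁ (posterior μ hyp m ω) (X ω) :=
    (measurable_bayes hf₀ hf₁).comp
      ((Measurable.mono measurable_posterior hmm' le_rfl).prodMk hXm')
  have key : ∀ h : Bool × Bool, ∀ A, MeasurableSet[m'] A →
      ∫⁻ ω in A, ENNReal.ofReal (bayes f₀ f₁ (posterior μ hyp m ω) (X ω) h) ∂μ =
        μ ({ω | hyp ω = h} ∩ A) := by
    intro h A hA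
    have hS : MeasurableSet {ω | hyp ω = h} := hhyp (measurableSet_singleton h)
    have hpd := isProbabilityMeasure_pdfMeasure_ite hf₀ hf₁ h.1
    have hd := measurable_ite_density hf₀ hf₁ h.1
    rw [← withDensity_apply _ (hle A hA), Set.inter_comm, ← Measure.restrict_apply' hS]
    refine measure_eq_of_inter_eq hm hXle ?_ (hm' ▸ hA)
    rintro s _ hs ⟨t, ht, rfl⟩
    have hst : MeasurableSet (s ∩ X ⁻¹' t) := (hm s hs).inter (hX.measurable ht)
    rw [withDensity_apply _ hst, Measure.restrict_apply hst, Set.inter_right_comm,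
      hX.measure_inter s hs h t ht, ← lintegral_indicator hst]
    -- The event `s` need not be a function of the posterior, so its indicator is carried as a
    -- second coordinate of `U` in `lintegral_nextObs`.
    have hsind : Measurable[m] (s.indicator fun _ => (1 : ℝ≥0∞)) :=
      Measurable.indicator measurable_const hs
    have htind : Measurable (t.indicator fun _ => (1 : ℝ≥0∞)) :=
      measurable_const.indicator ht
    have hg : Measurable fun p : ((Bool × Bool → ℝ) × ℝ≥0∞) × ℝ =>
        p.1.2 * (t.indicator (fun _ => 1) p.2 * ENNReal.ofReal (bayes f₀ f₁ p.1.1 p.2 h)) :=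
      (measurable_snd.comp measurable_fst).mul ((htind.comp measurable_snd).mul
        (((measurable_pi_iff.1 (measurable_bayes hf₀ hf₁) h).comp
          ((measurable_fst.comp measurable_fst).prodMk measurable_snd)).ennreal_ofReal))
    have hjoint := lintegral_nextObs hf₀ hf₁ hm hhyp hX
      (Measurable.prodMk (measurable_posterior (μ := μ) (hyp := hyp)) hsind) hg
    calc ∫⁻ ω, (s ∩ X ⁻¹' t).indicator
          (fun ω => ENNReal.ofReal (bayes f₀ f₁ (posterior μ hyp m ω) (X ω) h)) ω ∂μ
        = ∫⁻ ω, s.indicator (fun _ => 1) ω * (t.indicator (fun _ => 1) (X ω) *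
            ENNReal.ofReal (bayes f₀ f₁ (posterior μ hyp m ω) (X ω) h)) ∂μ := by
          refine lintegral_congr fun ω => ?_
          by_cases h1 : ω ∈ s <;> by_cases h2 : X ω ∈ t <;> simp [h1, h2]
      _ = ∫⁻ ω, s.indicator (fun ω => ENNReal.ofReal (posterior μ hyp m ω h) *
            pdfMeasure (if h.1 then f₁ else f₀) t) ω ∂μ := by
          rw [hjoint]
          refine lintegral_congr_ae ?_
          filter_upwards [posterior_mem_stdSimplex hm hhyp] with ω hr
          by_cases hω : ω ∈ s
          · simp only [Set.indicator_of_mem hω, one_mul]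
            rw [pdfMeasure, withDensity_apply _ ht, ← lintegral_indicator ht,
              ← lintegral_const_mul _ (hd.ennreal_ofReal.indicator ht)]
            refine lintegral_congr fun x => ?_
            by_cases hx : x ∈ t
            · simp only [Set.indicator_of_mem hx, one_mul]
              have hn := nextDensity_nonneg hf₀ hf₁ hr x
              rw [← ENNReal.ofReal_mul hn, ← ENNReal.ofReal_mul (hr.1 h)]
              congr 1
              -- If the mixture vanishes, each of its nonnegative summands vanishes, so both sides
              -- are `0` despite the division by zero in `bayes`.
              by_cases h0 : nextDensity f₀ f₁ (posterior μ hyp m ω) x = 0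
              · rw [h0, zero_mul]
                have hsum : ∑ h : Bool × Bool, posterior μ hyp m ω h *
                    (if h.1 then f₁ else f₀) x = nextDensity f₀ f₁ (posterior μ hyp m ω) x := by
                  simp only [Fintype.sum_prod_type, Fintype.sum_bool, nextDensity, if_true,
                    Bool.false_eq_true, if_false]
                  ring
                rw [h0, Finset.sum_eq_zero_iff_of_nonneg fun h _ =>
                  mul_nonneg (hr.1 h) (ite_density_nonneg hf₀ hf₁ h.1 x)] at hsum
                exact (hsum h (Finset.mem_univ h)).symm
              · rw [bayes, mul_div_cancel₀ _ h0, mul_comm]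
                split_ifs <;> rfl
            · simp [hx]
          · simp [hω]
      _ = μ (s ∩ {ω | hyp ω = h}) * pdfMeasure (if h.1 then f₁ else f₀) t := by
          rw [lintegral_indicator (hm s hs), lintegral_mul_const _
            ((measurable_posterior_apply h).mono hm le_rfl).ennreal_ofReal,
            setLIntegral_posterior hm hhyp h hs, Set.inter_comm]
  have hae : ∀ h : Bool × Bool,
      (fun ω => ENNReal.ofReal (bayes f₀ f₁ (posterior μ hyp m ω) (X ω) h)) =ᵐ[μ]
        fun ω => ENNReal.ofReal (posterior μ hyp m' ω h) := by
    intro h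
    have hS : MeasurableSet {ω | hyp ω = h} := hhyp (measurableSet_singleton h)
    -- Both functions are versions of the conditional expectation of the indicator of `hyp = h`
    -- given `m'`.
    refine (ae_eq_condLExp hle μ (({ω | hyp ω = h}).indicator fun _ => 1)
      (ENNReal.measurable_ofReal.comp ((measurable_pi_apply h).comp hB)) fun A hA => ?_).trans
      (ae_eq_condLExp hle μ _ (ENNReal.measurable_ofReal.comp (measurable_posterior_apply h))
        fun A hA => ?_).symm
    · refine (key h A hA).trans ?_
      rw [lintegral_indicator_const hS, one_mul, Measure.restrict_apply hS]
    · refine (setLIntegral_posterior hle hhyp h hA).trans ?_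
      rw [lintegral_indicator_const hS, one_mul, Measure.restrict_apply hS]
  filter_upwards [ae_all_iff.2 hae, posterior_mem_stdSimplex hm hhyp,
    posterior_mem_stdSimplex hle hhyp] with ω h1 hr hr'
  ext h
  have hb : 0 ≤ bayes f₀ f₁ (posterior μ hyp m ω) (X ω) h := by
    refine div_nonneg (mul_nonneg ?_ (hr.1 h)) (nextDensity_nonneg hf₀ hf₁ hr _)
    split_ifs
    exacts [hf₁.nonneg _, hf₀.nonneg _]
  exact ((ENNReal.ofReal_eq_ofReal_iff hb (hr'.1 h)).1 (h1 h)).symm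

/-- The Markov property in integrated form: replace the new posterior by its Bayes update, then
integrate `X` against the predictive density. -/
theorem setLIntegral_posterior_next (hf₀ : IsPDF f₀) (hf₁ : IsPDF f₁) (hm : m ≤ mΩ)
    (hhyp : Measurable hyp) (hX : IsNextObs f₀ f₁ μ hyp m X)
    (hm' : m' = m ⊔ MeasurableSpace.comap X inferInstance)
    {V : (Bool × Bool → ℝ) → ℝ} (hV : Measurable V) {M : ℝ}
    (hM : ∀ r ∈ stdSimplex ℝ (Bool × Bool), |V r| ≤ M)
    (h0 : ∀ r ∈ stdSimplex ℝ (Bool × Bool), 0 ≤ V r) {A : Set Ω} (hA : MeasurableSet[m] A) :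
    ∫⁻ ω in A, ENNReal.ofReal (V (posterior μ hyp m' ω)) ∂μ =
      ∫⁻ ω in A, ENNReal.ofReal (expectNext f₀ f₁ V (posterior μ hyp m ω)) ∂μ := by
  have hAind : Measurable[m] (A.indicator fun _ => (1 : ℝ≥0∞)) :=
    Measurable.indicator measurable_const hA
  have hg : Measurable fun p : ((Bool × Bool → ℝ) × ℝ≥0∞) × ℝ =>
      p.1.2 * ENNReal.ofReal (V (bayes f₀ f₁ p.1.1 p.2)) :=
    (measurable_snd.comp measurable_fst).mul (hV.comp ((measurable_bayes hf₀ hf₁).comp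
      ((measurable_fst.comp measurable_fst).prodMk measurable_snd))).ennreal_ofReal
  have hjoint := lintegral_nextObs hf₀ hf₁ hm hhyp hX
    (Measurable.prodMk (measurable_posterior (μ := μ) (hyp := hyp)) hAind) hg
  rw [← lintegral_indicator (hm A hA), ← lintegral_indicator (hm A hA)]
  calc _ = ∫⁻ ω, A.indicator (fun _ => 1) ω *
          ENNReal.ofReal (V (bayes f₀ f₁ (posterior μ hyp m ω) (X ω))) ∂μ := by
        refine lintegral_congr_ae ?_
        filter_upwards [posterior_eq_bayes hf₀ hf₁ hm hhyp hX hm'] with ω hω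
        by_cases h1 : ω ∈ A <;> simp [h1, hω]
    _ = _ := by
        rw [hjoint]
        refine lintegral_congr_ae ?_
        filter_upwards [posterior_mem_stdSimplex hm hhyp] with ω hr
        by_cases h1 : ω ∈ A
        · simp [h1, ofReal_expectNext hf₀ hf₁ hV hM h0 hr]
        · simp [h1]

end Posterior

/-! ### Optimal stopping with a cost per observation -/

section OptimalStopping

variable {Ω : Type*} {c : ℝ≥0∞} {S W N : ℕ → Ω → ℝ≥0∞} {τ : Ω → ℕ∞} {s : Set Ω}

/-- The cost of observing until time `τ ∧ n`, with terminal cost `W`. -/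
noncomputable def stoppedCost (c : ℝ≥0∞) (W : ℕ → Ω → ℝ≥0∞) (τ : Ω → ℕ∞) (n : ℕ) (ω : Ω) :
    ℝ≥0∞ :=
  c * ((min (τ ω) n : ℕ∞) : ℝ≥0∞) + W (min (τ ω) n).toNat ω

theorem stoppedCost_of_le {n : ℕ} {ω : Ω} (h : (n : ℕ∞) ≤ τ ω) :
    stoppedCost c W τ n ω = c * n + W n ω := by
  simp [stoppedCost, min_eq_right h]

theorem stoppedCost_of_ge {n : ℕ} {ω : Ω} (h : τ ω ≤ (n : ℕ∞)) :
    stoppedCost c W τ n ω = c * (τ ω : ℝ≥0∞) + W (τ ω).toNat ω := by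
  simp [stoppedCost, min_eq_left h]

variable [mΩ : MeasurableSpace Ω]

theorem measurable_of_isStoppingTime {G : Filtration ℕ mΩ} (hτ : IsStoppingTime G τ) :
    Measurable τ := by
  refine measurable_to_countable' fun n => ?_
  cases n with
  | top =>
    have : τ ⁻¹' {⊤} = ⋂ i : ℕ, {ω | τ ω ≤ (i : ℕ∞)}ᶜ := by
      ext ω
      simp only [Set.mem_preimage, Set.mem_singleton_iff, Set.mem_iInter, Set.mem_compl_iff,
        Set.mem_ofPred_eq, not_le]
      exact ENat.eq_top_iff_forall_gt
    rw [this]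
    exact MeasurableSet.iInter fun i => (G.le i _ (hτ i)).compl
  | coe i => exact G.le i _ (hτ.measurableSet_eq i)

variable {μ : Measure Ω} {G : Filtration ℕ mΩ}

theorem measurable_stoppedCost (hτ : IsStoppingTime G τ) (hW : ∀ n, Measurable (W n)) (n : ℕ) :
    Measurable (stoppedCost c W τ n) := by
  have h : Measurable fun p : ℕ∞ × Ω =>
      c * ((min p.1 n : ℕ∞) : ℝ≥0∞) + W (min p.1 n).toNat p.2 :=
    measurable_from_prod_countable_right fun k =>
      (hW (min k n).toNat).const_add (c * ((min k n : ℕ∞) : ℝ≥0∞))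
  exact h.comp ((measurable_of_isStoppingTime hτ).prodMk measurable_id)

/-- Arranged for comparison with `setLIntegral_stoppedCost_succ`: the two right-hand sides differ
only by `W n` against `c + N n` on the part of `s` where `τ > n`. -/
theorem setLIntegral_stoppedCost (hτ : IsStoppingTime G τ) (n : ℕ) :
    ∫⁻ ω in s, stoppedCost c W τ n ω ∂μ =
      ∫⁻ ω in s ∩ {ω | τ ω ≤ n}, stoppedCost c W τ n ω ∂μ +
        ∫⁻ ω in s \ {ω | τ ω ≤ n}, W n ω ∂μ + c * n * μ (s \ {ω | τ ω ≤ n}) := by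
  have hm : MeasurableSet {ω | τ ω ≤ n} := G.le n _ (hτ n)
  rw [← lintegral_inter_add_sdiff _ s hm, add_assoc, add_comm (∫⁻ ω in s \ _, _ ∂μ),
    ← setLIntegral_const, ← lintegral_add_left measurable_const]
  congr 1
  rw [Set.sdiff_eq]
  refine lintegral_congr_ae ?_
  have hc : ∀ᵐ ω ∂μ.restrict {ω | τ ω ≤ n}ᶜ, ω ∈ {ω | τ ω ≤ n}ᶜ := ae_restrict_mem hm.compl
  filter_upwards [ae_mono (Measure.restrict_mono Set.inter_subset_right le_rfl) hc] with ω hω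
  have h1 : ¬ τ ω ≤ n := hω
  exact stoppedCost_of_le (not_le.1 h1).le

/-- Where `τ > n`, one further observation is paid for. That event is known at time `n`, so `hWN`
may replace `W (n + 1)` by `N n` on it. -/
theorem setLIntegral_stoppedCost_succ (hτ : IsStoppingTime G τ) (hs : MeasurableSet[G 0] s)
    (hWN : ∀ n A, MeasurableSet[G n] A → ∫⁻ ω in A, W (n + 1) ω ∂μ = ∫⁻ ω in A, N n ω ∂μ)
    (n : ℕ) :
    ∫⁻ ω in s, stoppedCost c W τ (n + 1) ω ∂μ =
      ∫⁻ ω in s ∩ {ω | τ ω ≤ n}, stoppedCost c W τ n ω ∂μ +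
        ∫⁻ ω in s \ {ω | τ ω ≤ n}, (c + N n ω) ∂μ + c * n * μ (s \ {ω | τ ω ≤ n}) := by
  have hm : MeasurableSet {ω | τ ω ≤ n} := G.le n _ (hτ n)
  have hsn : MeasurableSet[G n] (s \ {ω | τ ω ≤ n}) :=
    (G.mono (Nat.zero_le n) s hs).diff (hτ n)
  have hs' : MeasurableSet s := G.le 0 s hs
  rw [← lintegral_inter_add_sdiff _ s hm, add_assoc, lintegral_add_left measurable_const,
    ← hWN n _ hsn, add_comm (∫⁻ _ in s \ _, c ∂μ), add_assoc, setLIntegral_const, ← add_mul,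
    add_comm (∫⁻ ω in s \ _, _ ∂μ) (_ * _), ← setLIntegral_const,
    ← lintegral_add_left measurable_const]
  congr 1
  · refine setLIntegral_congr_fun (hs'.inter hm) fun ω hω => ?_
    have h1 : τ ω ≤ n := hω.2
    rw [stoppedCost_of_ge h1, stoppedCost_of_ge (h1.trans (by exact_mod_cast Nat.le_succ n))]
  · refine setLIntegral_congr_fun (hs'.diff hm) fun ω hω => ?_
    have h1 : (n : ℕ∞) < τ ω := not_le.1 hω.2
    rw [stoppedCost_of_le (n := n + 1) (by exact_mod_cast Order.add_one_le_of_lt h1)]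
    push_cast
    ring

theorem setLIntegral_stoppedCost_zero :
    ∫⁻ ω in s, stoppedCost c W τ 0 ω ∂μ = ∫⁻ ω in s, W 0 ω ∂μ :=
  lintegral_congr fun ω => by simp [stoppedCost]

/-- Here `W` is the value, `N` its one-step prediction and `S` the stopping cost. Since `W n ≤ c + N
n`, the truncated costs increase in `n` in the mean, starting from the integral of `W 0`. -/
theorem le_setLIntegral_cost [IsFiniteMeasure μ] (hτ : IsStoppingTime G τ)
    (hs : MeasurableSet[G 0] s) (hc : c ≠ 0)
    (hWN : ∀ n A, MeasurableSet[G n] A → ∫⁻ ω in A, W (n + 1) ω ∂μ = ∫⁻ ω in A, N n ω ∂μ)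
    (hWS : ∀ n, W n ≤ᵐ[μ] S n) (hcont : ∀ n, ∀ᵐ ω ∂μ, W n ω ≤ c + N n ω)
    (hone : ∀ n, ∀ᵐ ω ∂μ, W n ω ≤ 1) :
    ∫⁻ ω in s, W 0 ω ∂μ ≤ ∫⁻ ω in s, (c * (τ ω : ℝ≥0∞) + S (τ ω).toNat ω) ∂μ := by
  have hs' : MeasurableSet s := G.le 0 s hs
  have hm : ∀ n : ℕ, MeasurableSet {ω | τ ω ≤ n} := fun n => G.le n _ (hτ n)
  have hmono : ∀ n, ∫⁻ ω in s, W 0 ω ∂μ ≤ ∫⁻ ω in s, stoppedCost c W τ n ω ∂μ := by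
    intro n
    induction n with
    | zero => exact setLIntegral_stoppedCost_zero.ge
    | succ n ih =>
      refine ih.trans ?_
      rw [setLIntegral_stoppedCost hτ, setLIntegral_stoppedCost_succ hτ hs hWN]
      refine add_le_add_left (add_le_add_right ?_ _) _
      exact lintegral_mono_ae (ae_restrict_of_ae (hcont n))
  -- Truncation charges `W n ≤ 1` in place of the true remaining cost, and only where `τ > n`; this
  -- is the error term.
  have hbound : ∀ n : ℕ, ∫⁻ ω in s, W 0 ω ∂μ ≤
      ∫⁻ ω in s, (c * (τ ω : ℝ≥0∞) + S (τ ω).toNat ω) ∂μ + μ (s \ {ω | τ ω ≤ n}) := by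
    intro n
    refine (hmono n).trans ?_
    rw [← lintegral_inter_add_sdiff _ s (hm n),
      ← lintegral_inter_add_sdiff (fun ω => c * (τ ω : ℝ≥0∞) + S (τ ω).toNat ω) s (hm n),
      add_assoc]
    refine add_le_add ?_ ?_
    · refine setLIntegral_mono_ae' (hs'.inter (hm n)) ?_
      filter_upwards [ae_all_iff.2 hWS] with ω h hω
      rw [stoppedCost_of_ge hω.2]
      gcongr
      exact h _
    · rw [← setLIntegral_one, ← lintegral_add_right _ measurable_const]
      refine setLIntegral_mono_ae' (hs'.diff (hm n)) ?_
      filter_upwards [hone n] with ω h hω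
      have h1 : (n : ℕ∞) ≤ τ ω := (not_le.1 hω.2).le
      rw [stoppedCost_of_le h1]
      have h2 : (n : ℝ≥0∞) ≤ (τ ω : ℝ≥0∞) := by
        simpa using ENat.toENNReal_mono h1
      gcongr
      exact le_add_right (mul_le_mul_right h2 c)
  -- If `τ` is almost surely finite on `s` the error tends to `0`; otherwise the right-hand side is
  -- infinite because `c ≠ 0`.
  by_cases htop : μ (s ∩ τ ⁻¹' {⊤}) = 0
  · have hlim : Filter.Tendsto (fun n : ℕ => μ (s \ {ω | τ ω ≤ n})) Filter.atTop (nhds 0) := by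
      rw [← htop]
      have hinter : s ∩ τ ⁻¹' {⊤} = ⋂ n : ℕ, s \ {ω | τ ω ≤ n} := by
        ext ω
        simp only [Set.mem_inter_iff, Set.mem_preimage, Set.mem_singleton_iff, Set.mem_iInter,
          Set.mem_sdiff, Set.mem_ofPred_eq, not_le, forall_and, forall_const]
        rw [ENat.eq_top_iff_forall_gt]
      rw [hinter]
      refine tendsto_measure_iInter_atTop (fun n => (hs'.diff (hm n)).nullMeasurableSet)
        (fun a b hab => Set.sdiff_subset_sdiff_right fun ω hω => ?_) ⟨0, measure_ne_top _ _⟩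
      have h1 : τ ω ≤ a := hω
      exact h1.trans (by exact_mod_cast hab)
    have := ge_of_tendsto' (hlim.const_add
      (∫⁻ ω in s, (c * (τ ω : ℝ≥0∞) + S (τ ω).toNat ω) ∂μ)) hbound
    simpa using this
  · have hT : MeasurableSet (s ∩ τ ⁻¹' {⊤}) :=
      hs'.inter (measurable_of_isStoppingTime hτ (measurableSet_singleton _))
    refine le_top.trans ?_
    calc ⊤ = ∫⁻ ω in s ∩ τ ⁻¹' {⊤}, (⊤ : ℝ≥0∞) ∂μ := by
          rw [setLIntegral_const, ENNReal.top_mul htop]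
      _ ≤ ∫⁻ ω in s ∩ τ ⁻¹' {⊤}, (c * (τ ω : ℝ≥0∞) + S (τ ω).toNat ω) ∂μ := by
          refine setLIntegral_mono' hT fun ω hω => ?_
          have : τ ω = ⊤ := hω.2
          simp [this, ENNReal.mul_top hc]
      _ ≤ _ := lintegral_mono_set Set.inter_subset_left

/-- Equality in the continuation branch before `τ` keeps the truncated costs constant in the mean.
Fatou then needs neither a bound on `W` nor prior knowledge that `τ` is finite. -/
theorem setLIntegral_cost_le (hτ : IsStoppingTime G τ)
    (hs : MeasurableSet[G 0] s) (hc : c ≠ 0) (hW : ∀ n, Measurable (W n))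
    (hWN : ∀ n A, MeasurableSet[G n] A → ∫⁻ ω in A, W (n + 1) ω ∂μ = ∫⁻ ω in A, N n ω ∂μ)
    (hcont : ∀ n : ℕ, ∀ᵐ ω ∂μ, (n : ℕ∞) < τ ω → W n ω = c + N n ω)
    (hfinal : ∀ n : ℕ, ∀ᵐ ω ∂μ, τ ω = n → W n ω = S n ω) :
    ∫⁻ ω in s, (c * (τ ω : ℝ≥0∞) + S (τ ω).toNat ω) ∂μ ≤ ∫⁻ ω in s, W 0 ω ∂μ := by
  have hs' : MeasurableSet s := G.le 0 s hs
  have hm : ∀ n : ℕ, MeasurableSet {ω | τ ω ≤ n} := fun n => G.le n _ (hτ n)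
  have hconst : ∀ n, ∫⁻ ω in s, stoppedCost c W τ n ω ∂μ = ∫⁻ ω in s, W 0 ω ∂μ := by
    intro n
    induction n with
    | zero => exact setLIntegral_stoppedCost_zero
    | succ n ih =>
      rw [← ih, setLIntegral_stoppedCost_succ hτ hs hWN, setLIntegral_stoppedCost hτ (s := s)]
      congr 2
      refine setLIntegral_congr_fun_ae (hs'.diff (hm n)) ?_
      filter_upwards [hcont n] with ω h hω
      exact (h (not_le.1 hω.2)).symm
  -- Pointwise the truncated costs converge to the full cost: they are eventually constant where `τ`
  -- is finite, and exceed `c * n` where it is not.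
  calc ∫⁻ ω in s, (c * (τ ω : ℝ≥0∞) + S (τ ω).toNat ω) ∂μ
      = ∫⁻ ω in s, Filter.liminf (fun n => stoppedCost c W τ n ω) Filter.atTop ∂μ := by
        refine lintegral_congr_ae (ae_restrict_of_ae ?_)
        filter_upwards [ae_all_iff.2 hfinal] with ω h
        refine (Filter.Tendsto.liminf_eq ?_).symm
        cases hτω : τ ω with
        | top =>
          have h1 : Filter.Tendsto (fun n : ℕ => c * (n : ℝ≥0∞)) Filter.atTop (nhds (c * ⊤)) :=
            ENNReal.Tendsto.const_mul ENNReal.tendsto_nat_nhds_top (Or.inl ENNReal.top_ne_zero)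
          rw [ENNReal.mul_top hc] at h1
          rw [ENat.toENNReal_top, ENNReal.mul_top hc, top_add]
          refine tendsto_nhds_top_mono' h1 fun n => ?_
          simp only
          rw [stoppedCost_of_le (hτω ▸ le_top)]
          exact le_self_add
        | coe k =>
          refine tendsto_const_nhds.congr' ?_
          filter_upwards [Filter.eventually_ge_atTop k] with n hn
          have h1 : τ ω ≤ n := hτω ▸ (by exact_mod_cast hn)
          rw [stoppedCost_of_ge h1, hτω, ENat.toNat_natCast, h k hτω]
    _ ≤ Filter.liminf (fun n => ∫⁻ ω in s, stoppedCost c W τ n ω ∂μ) Filter.atTop :=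
        lintegral_liminf_le fun n => measurable_stoppedCost hτ hW n
    _ = _ := by simp [hconst]

end OptimalStopping

/-! ### The next sample is fresh -/

section Model

variable {f₀ f₁ : ℝ → ℝ} {π₀ : ℝ}

theorem infinitePi_inter_succ (P : Measure ℝ) [IsProbabilityMeasure P] (n : ℕ)
    {S : Set (Finset.range (n + 1) → ℝ)} (hS : MeasurableSet S) {B : Set ℝ}
    (hB : MeasurableSet B) :
    Measure.infinitePi (fun _ : ℕ => P) ({y | (fun i : Finset.range (n + 1) => y i) ∈ S} ∩
      {y | y (n + 1) ∈ B}) =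
      Measure.infinitePi (fun _ : ℕ => P) {y | (fun i : Finset.range (n + 1) => y i) ∈ S} *
        P B := by
  have hind : iIndepFun (fun (i : ℕ) (y : ℕ → ℝ) => y i) (Measure.infinitePi fun _ : ℕ => P) :=
    iIndepFun_infinitePi (X := fun _ x => x) fun _ => measurable_id
  have hdisj : Disjoint (Finset.range (n + 1)) {n + 1} := by simp
  have h := hind.indepFun_finset _ _ hdisj fun i => measurable_pi_apply i
  have h2 := (h.comp measurable_id (measurable_pi_apply
    (⟨n + 1, Finset.mem_singleton_self _⟩ : ({n + 1} : Finset ℕ)))).measure_inter_preimage_eq_mul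
      S B hS hB
  have h3 : Measure.infinitePi (fun _ : ℕ => P) {y | y (n + 1) ∈ B} = P B := by
    conv_rhs => rw [← Measure.infinitePi_map_eval (fun _ : ℕ => P) (n + 1)]
    exact (Measure.map_apply (measurable_pi_apply (X := fun _ : ℕ => ℝ) (n + 1)) hB).symm
  rw [← h3]
  exact h2

theorem sequenceLaw_apply (hf₀ : IsPDF f₀) (hf₁ : IsPDF f₁) {T : Set (Bool × (ℕ → ℝ))}
    (hT : MeasurableSet T) :
    sequenceLaw f₀ f₁ π₀ T =
      ENNReal.ofReal π₀ * Measure.infinitePi (fun _ : ℕ => pdfMeasure f₁) (Prod.mk true ⁻¹' T) +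
      ENNReal.ofReal (1 - π₀) *
        Measure.infinitePi (fun _ : ℕ => pdfMeasure f₀) (Prod.mk false ⁻¹' T) := by
  have := hf₀.isProbabilityMeasure
  have := hf₁.isProbabilityMeasure
  rw [sequenceLaw, Measure.add_apply, Measure.smul_apply, Measure.smul_apply,
    Measure.dirac_prod, Measure.dirac_prod, Measure.map_apply measurable_prodMk_left hT,
    Measure.map_apply measurable_prodMk_left hT, smul_eq_mul, smul_eq_mul]

/-- Fixing the hypothesis leaves one component of the mixture, an i.i.d. law, to which
`infinitePi_inter_succ` applies. -/
theorem sequenceLaw_inter_succ (hf₀ : IsPDF f₀) (hf₁ : IsPDF f₁) (n : ℕ) (a : Bool)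
    {S : Set (Bool × (Finset.range (n + 1) → ℝ))} (hS : MeasurableSet S) {B : Set ℝ}
    (hB : MeasurableSet B) :
    sequenceLaw f₀ f₁ π₀ ({p | (p.1, fun i : Finset.range (n + 1) => p.2 i) ∈ S} ∩
      {p | p.1 = a} ∩ {p | p.2 (n + 1) ∈ B}) =
      sequenceLaw f₀ f₁ π₀ ({p | (p.1, fun i : Finset.range (n + 1) => p.2 i) ∈ S} ∩
        {p | p.1 = a}) * pdfMeasure (if a then f₁ else f₀) B := by
  have := hf₀.isProbabilityMeasure
  have := hf₁.isProbabilityMeasure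
  have h1 : Measurable fun p : Bool × (ℕ → ℝ) =>
      (p.1, fun i : Finset.range (n + 1) => p.2 i) := by fun_prop
  have h2 : MeasurableSet ({p | (p.1, fun i : Finset.range (n + 1) => p.2 i) ∈ S} ∩
      {p : Bool × (ℕ → ℝ) | p.1 = a}) :=
    (h1 hS).inter (measurable_fst (measurableSet_singleton a))
  have h3 : MeasurableSet {p : Bool × (ℕ → ℝ) | p.2 (n + 1) ∈ B} :=
    ((measurable_pi_apply (n + 1)).comp measurable_snd) hB
  have hSb : ∀ b : Bool, MeasurableSet
      ((Prod.mk b : (Finset.range (n + 1) → ℝ) → Bool × (Finset.range (n + 1) → ℝ)) ⁻¹' S) :=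
    fun b => measurable_prodMk_left hS
  rw [sequenceLaw_apply hf₀ hf₁ (h2.inter h3), sequenceLaw_apply hf₀ hf₁ h2]
  have hne : ∀ b : Bool, b ≠ a → (Prod.mk b : (ℕ → ℝ) → Bool × (ℕ → ℝ)) ⁻¹'
      ({p | (p.1, fun i : Finset.range (n + 1) => p.2 i) ∈ S} ∩ {p | p.1 = a}) = ∅ := by
    intro b hb
    ext y
    simp [hb]
  have heq : (Prod.mk a : (ℕ → ℝ) → Bool × (ℕ → ℝ)) ⁻¹'
      ({p | (p.1, fun i : Finset.range (n + 1) => p.2 i) ∈ S} ∩ {p | p.1 = a}) =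
        {y | (fun i : Finset.range (n + 1) => y i) ∈ Prod.mk a ⁻¹' S} := by
    ext y
    simp
  have hBp : ∀ b : Bool, (Prod.mk b : (ℕ → ℝ) → Bool × (ℕ → ℝ)) ⁻¹'
      {p | p.2 (n + 1) ∈ B} = {y | y (n + 1) ∈ B} := fun b => rfl
  rw [Set.preimage_inter (s := _ ∩ _), Set.preimage_inter (s := _ ∩ _) (f := Prod.mk false),
    hBp, hBp]
  cases a
  · rw [hne true (by simp), heq, infinitePi_inter_succ _ n (hSb false) hB]
    simp [mul_assoc]
  · rw [hne false (by simp), heq, infinitePi_inter_succ _ n (hSb true) hB]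
    simp [mul_assoc]

variable {Ω : Type*}

/-- The hypothesis of sequence `s` and its samples up to slot `n`. -/
def seqPast (θ : ℕ → Ω → Bool) (Y : ℕ → ℕ → Ω → ℝ) (n s : ℕ) (ω : Ω) :
    Bool × (Finset.range (n + 1) → ℝ) :=
  (θ s ω, fun i => Y s i ω)

/-- All hypotheses, and the samples of all sequences up to slot `n`. -/
@[reducible] def pastInfo (θ : ℕ → Ω → Bool) (Y : ℕ → ℕ → Ω → ℝ) (n : ℕ) : MeasurableSpace Ω :=
  ⨆ s, MeasurableSpace.comap (seqPast θ Y n s) inferInstance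

variable {θ : ℕ → Ω → Bool} {Y : ℕ → ℕ → Ω → ℝ}

theorem measurable_seqPast_pastInfo (n s : ℕ) : Measurable[pastInfo θ Y n] (seqPast θ Y n s) :=
  Measurable.of_comap_le (le_iSup (fun s => MeasurableSpace.comap (seqPast θ Y n s) _) s)

theorem measurable_hyp_pastInfo (n s : ℕ) : Measurable[pastInfo θ Y n] (θ s) :=
  measurable_fst.comp (measurable_seqPast_pastInfo n s)

theorem measurable_sample_pastInfo {n i : ℕ} (s : ℕ) (h : i ≤ n) :
    Measurable[pastInfo θ Y n] (Y s i) :=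
  (measurable_pi_apply (⟨i, Finset.mem_range.2 (Nat.lt_succ_of_le h)⟩ : Finset.range (n + 1))).comp
    (measurable_snd.comp (measurable_seqPast_pastInfo n s))

/-- The pair scanned at slot `i` is chosen by decisions from earlier slots, hence the strong
induction. A random choice of sequence is harmless because `pastInfo` contains the samples of all of
them. -/
theorem measurable_rule_pastInfo {φ : ℕ → Ω → Bool} (hφ : IsSwitchingRule Y φ) {n k : ℕ}
    (hk : k ≤ n) : Measurable[pastInfo θ Y n] (φ k) ∧ scanInfo Y φ k ≤ pastInfo θ Y n := by
  induction k using Nat.strong_induction_on with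
  | _ k ih =>
    have hle : scanInfo Y φ k ≤ pastInfo θ Y n := by
      refine iSup₂_le fun i hi => ?_
      have hik := (Finset.mem_Icc.1 hi).2
      have hp : Measurable[pastInfo θ Y n] (pairIndex φ i) :=
        @measurable_pairIndex _ (pastInfo θ Y n) _ _ fun l hl =>
          (ih l (hl.trans_le hik) ((hl.trans_le hik).le.trans hk)).1
      have hsel : ∀ S : Ω → ℕ, Measurable[pastInfo θ Y n] S →
          Measurable[pastInfo θ Y n] fun ω => Y (S ω) i ω := fun S hS =>
        @measurable_select _ (pastInfo θ Y n) (fun s _ => Y s i)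
          (fun s _ => measurable_sample_pastInfo s (hik.trans hk)) S (fun _ => i) hS
          measurable_const
      have hZ : Measurable[pastInfo θ Y n] (scanObs Y φ i) :=
        Measurable.add (hsel _ (Measurable.const_mul hp 2))
          (hsel _ (Measurable.add_const (Measurable.const_mul hp 2) 1))
      exact Measurable.comap_le hZ
    exact ⟨(hφ k).mono hle le_rfl, hle⟩

variable [mΩ : MeasurableSpace Ω] {μ : Measure Ω}

theorem IsSearchModel.measurable_path (hM : IsSearchModel f₀ f₁ π₀ μ θ Y) (s : ℕ) :
    Measurable fun ω => (θ s ω, fun k => Y s k ω) :=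
  (hM.measurable_hyp s).prodMk (measurable_pi_lambda _ fun k => hM.measurable_sample s k)

/-- The past splits into the past of sequence `s` and that of the others. The others are independent
of the whole path of `s`; within that path, `sequenceLaw_inter_succ` supplies the fresh sample. -/
theorem IsSearchModel.measure_past_inter_sample [IsProbabilityMeasure μ] (hf₀ : IsPDF f₀)
    (hf₁ : IsPDF f₁) (hM : IsSearchModel f₀ f₁ π₀ μ θ Y) (s n : ℕ) (a : Bool) {A : Set Ω}
    (hA : MeasurableSet[pastInfo θ Y n] A) {B : Set ℝ} (hB : MeasurableSet B) :
    μ (A ∩ {ω | θ s ω = a} ∩ Y s (n + 1) ⁻¹' B) =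
      μ (A ∩ {ω | θ s ω = a}) * pdfMeasure (if a then f₁ else f₀) B := by
  have := isProbabilityMeasure_pdfMeasure_ite hf₀ hf₁ a
  set path : ℕ → Ω → Bool × (ℕ → ℝ) := fun s ω => (θ s ω, fun k => Y s k ω) with hpath
  have hpm : ∀ t, Measurable (path t) := hM.measurable_path
  have hrestr : Measurable fun p : Bool × (ℕ → ℝ) =>
      (p.1, fun i : Finset.range (n + 1) => p.2 i) := by fun_prop
  have hseq : ∀ t, MeasurableSpace.comap (seqPast θ Y n t) inferInstance ≤
      MeasurableSpace.comap (path t) inferInstance := by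
    rintro t _ ⟨S, hS, rfl⟩
    exact ⟨_, hrestr hS, rfl⟩
  have hple : ∀ t, MeasurableSpace.comap (path t) inferInstance ≤ mΩ := fun t =>
    (hpm t).comap_le
  have hOle : (⨆ t ∈ ({s}ᶜ : Set ℕ), MeasurableSpace.comap (path t) inferInstance) ≤ mΩ :=
    iSup₂_le fun t _ => hple t
  have hind := indep_iSup_of_disjoint hple hM.indep.iIndep
    (S := {s}) (T := {s}ᶜ) (Set.disjoint_left.2 fun t h1 h2 => h2 h1)
  rw [iSup_singleton, Indep_iff] at hind
  -- The other sequences may be included with their entire paths, future samples too; this lets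
  -- independence of paths be used directly.
  have hAle : pastInfo θ Y n ≤ MeasurableSpace.comap (seqPast θ Y n s) inferInstance ⊔
      ⨆ t ∈ ({s}ᶜ : Set ℕ), MeasurableSpace.comap (path t) inferInstance := by
    refine iSup_le fun t => ?_
    by_cases hts : t = s
    · subst hts
      exact le_sup_left
    · exact (hseq t).trans ((le_iSup₂_of_le (f := fun t (_ : t ∈ ({s}ᶜ : Set ℕ)) =>
        MeasurableSpace.comap (path t) inferInstance) t hts le_rfl).trans le_sup_right)
  have hθ : MeasurableSet {ω | θ s ω = a} := hM.measurable_hyp s (measurableSet_singleton a)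
  have hYB : MeasurableSet (Y s (n + 1) ⁻¹' B) := hM.measurable_sample s (n + 1) hB
  have hBtop : pdfMeasure (if a then f₁ else f₀) B ≠ ∞ := measure_ne_top _ _
  have : IsFiniteMeasure
      (pdfMeasure (if a then f₁ else f₀) B • μ.restrict {ω | θ s ω = a}) :=
    Measure.smul_finite _ hBtop
  have key := measure_eq_of_inter_eq (hseq s |>.trans (hple s)) hOle
    (ν₁ := μ.restrict ({ω | θ s ω = a} ∩ Y s (n + 1) ⁻¹' B))
    (ν₂ := pdfMeasure (if a then f₁ else f₀) B • μ.restrict {ω | θ s ω = a}) ?_ (hAle A hA)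
  · rw [Measure.restrict_apply' (hθ.inter hYB), Measure.smul_apply,
      Measure.restrict_apply' hθ, smul_eq_mul, ← Set.inter_assoc] at key
    rw [key, mul_comm]
  · rintro _ t ⟨S, hS, rfl⟩ ht
    rw [Measure.restrict_apply' (hθ.inter hYB), Measure.smul_apply,
      Measure.restrict_apply' hθ, smul_eq_mul, Set.inter_right_comm _ t, Set.inter_right_comm _ t]
    have hT1 : MeasurableSet ({p | (p.1, fun i : Finset.range (n + 1) => p.2 i) ∈ S} ∩
        {p : Bool × (ℕ → ℝ) | p.1 = a}) :=
      (hrestr hS).inter (measurable_fst (measurableSet_singleton a))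
    have hT2 : MeasurableSet {p : Bool × (ℕ → ℝ) | p.2 (n + 1) ∈ B} :=
      ((measurable_pi_apply (n + 1)).comp measurable_snd) hB
    have hl := sequenceLaw_inter_succ (π₀ := π₀) hf₀ hf₁ n a hS hB
    rw [← hM.law s, Measure.map_apply (hpm s) (hT1.inter hT2), Measure.map_apply (hpm s) hT1] at hl
    rw [← Set.inter_assoc]
    have e1 := hind _ t ⟨_, hT1.inter hT2, rfl⟩ ht
    have e2 := hind _ t ⟨_, hT1, rfl⟩ ht
    refine e1.trans (Eq.trans ?_ (congrArg (pdfMeasure (if a then f₁ else f₀) B * ·) e2.symm))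
    rw [← mul_assoc, mul_comm (pdfMeasure _ B)]
    exact congrArg (· * μ t) hl

variable {φ : ℕ → Ω → Bool} {τ₀ : Ω → ℕ∞}

theorem measurable_candidateHyp (hθ : ∀ s, Measurable (θ s)) (hY : ∀ s k, Measurable (Y s k))
    (hφ : IsSwitchingRule Y φ) (hτ₀ : IsStoppingTime (scanFiltration hY hφ) τ₀) :
    Measurable (candidateHyp θ φ τ₀) := by
  have hτ : Measurable fun ω => (τ₀ ω).toNat :=
    (measurable_from_top (f := ENat.toNat)).comp (measurable_of_isStoppingTime hτ₀)
  have hp : Measurable fun ω => pairIndex φ (τ₀ ω).toNat ω := by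
    have h : Measurable fun p : ℕ × Ω => pairIndex φ p.1 p.2 :=
      measurable_from_prod_countable_right fun q =>
        measurable_pairIndex fun i _ => measurable_rule hY hφ i
    exact h.comp (hτ.prodMk measurable_id)
  have hs : Measurable fun p : ℕ × Ω => θ p.1 p.2 :=
    measurable_from_prod_countable_right fun q => hθ q
  exact (hs.comp ((hp.const_mul 2).prodMk measurable_id)).prodMk
    (hs.comp (((hp.const_mul 2).add_const 1).prodMk measurable_id))

/-- Once the values of `τ₀` and the pair index are fixed, every observation generating `G_j` is a
sample at a deterministic slot, at most `k + j`. -/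
theorem measurableSet_pastInfo_of_refineFiltration (hY : ∀ s k, Measurable (Y s k))
    (hφ : IsSwitchingRule Y φ) (hτ₀ : IsStoppingTime (scanFiltration hY hφ) τ₀) (j k n : ℕ)
    {A : Set Ω} (hA : MeasurableSet[refineFiltration hY hφ hτ₀ j] A) :
    MeasurableSet[pastInfo θ Y (k + j)]
      (A ∩ ({ω | τ₀ ω = k} ∩ {ω | pairIndex φ k ω = n})) := by
  set C : Set Ω := {ω | τ₀ ω = k} ∩ {ω | pairIndex φ k ω = n} with hC
  have hscan : scanInfo Y φ k ≤ pastInfo θ Y (k + j) :=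
    (measurable_rule_pastInfo hφ (Nat.le_add_right k j)).2
  have hCm : MeasurableSet[pastInfo θ Y (k + j)] C := by
    refine MeasurableSet.inter (hscan _ (hτ₀.measurableSet_eq k)) ?_
    have hp : Measurable[pastInfo θ Y (k + j)] (pairIndex φ k) :=
      @measurable_pairIndex _ (pastInfo θ Y (k + j)) _ _ fun l hl =>
        (measurable_rule_pastInfo hφ (hl.le.trans (Nat.le_add_right k j))).1
    exact hp (measurableSet_singleton n)
  -- Comparing traces on `C` as σ-algebras reduces the claim to generators.
  have hle : refineFiltration hY hφ hτ₀ j ≤ MeasurableSpace.map (Subtype.val : C → Ω)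
      (MeasurableSpace.comap Subtype.val (pastInfo θ Y (k + j))) := by
    refine sup_le (fun s hs => ?_) (iSup₂_le fun i hi => ?_)
    · refine ⟨s ∩ {ω | τ₀ ω ≤ k}, hscan _ (hs.2 k), ?_⟩
      rw [Subtype.preimage_val_eq_preimage_val_iff]
      ext ω
      simp only [hC, Set.mem_inter_iff, Set.mem_ofPred_eq]
      constructor
      · tauto
      · rintro ⟨⟨h1, h2⟩, h3⟩
        exact ⟨⟨h1, h2⟩, h3, h1.le⟩
    · rintro _ ⟨B, hB, rfl⟩
      refine ⟨Y (2 * n) (k + i) ⁻¹' B, measurable_sample_pastInfo _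
        (Nat.add_le_add_left (Finset.mem_Icc.1 hi).2 k) hB, ?_⟩
      ext ⟨ω, h1, h2⟩
      have h1' : τ₀ ω = k := h1
      have h2' : pairIndex φ k ω = n := h2
      simp [refineObs, h1', h2']
  obtain ⟨H, hH, hHA⟩ := hle A hA
  rw [Subtype.preimage_val_eq_preimage_val_iff] at hHA
  rw [Set.inter_comm, ← hHA]
  exact MeasurableSet.inter hCm hH

theorem IsSearchModel.isNextObs [IsProbabilityMeasure μ] (hf₀ : IsPDF f₀) (hf₁ : IsPDF f₁)
    (hM : IsSearchModel f₀ f₁ π₀ μ θ Y) (hφ : IsSwitchingRule Y φ)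
    (hτ₀ : IsStoppingTime (scanFiltration hM.measurable_sample hφ) τ₀)
    (hfin : ∀ᵐ ω ∂μ, τ₀ ω ≠ ⊤) (j : ℕ) :
    IsNextObs f₀ f₁ μ (candidateHyp θ φ τ₀) (refineFiltration hM.measurable_sample hφ hτ₀ j)
      (refineObs Y φ τ₀ (j + 1)) := by
  have hX := measurable_refineObs hM.measurable_sample hφ hτ₀ (j + 1)
  have hh := measurable_candidateHyp hM.measurable_hyp hM.measurable_sample hφ hτ₀
  refine ⟨hX, fun A hA h B hB => ?_⟩
  -- These cells cover almost all of `Ω` because `τ₀` is almost surely finite. The factor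
  -- contributed by the new sample is the same on every cell, so the sum over cells factors.
  let C : ℕ × ℕ → Set Ω := fun p => {ω | τ₀ ω = p.1} ∩ {ω | pairIndex φ p.1 ω = p.2}
  have hCm : ∀ p, MeasurableSet (C p) := fun p =>
    ((scanFiltration hM.measurable_sample hφ).le _ _ (hτ₀.measurableSet_eq p.1)).inter
      ((measurable_pairIndex fun i _ => measurable_rule hM.measurable_sample hφ i)
        (measurableSet_singleton p.2))
  have hCd : Pairwise (Function.onFun Disjoint C) := by
    rintro p q hpq
    refine Set.disjoint_left.2 ?_
    rintro ω ⟨h1 : τ₀ ω = p.1, h2 : pairIndex φ p.1 ω = p.2⟩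
      ⟨h3 : τ₀ ω = q.1, h4 : pairIndex φ q.1 ω = q.2⟩
    have h5 : p.1 = q.1 := by exact_mod_cast h1.symm.trans h3
    exact hpq (Prod.ext h5 (by rw [← h2, ← h4, h5]))
  have hsum : ∀ T : Set Ω, MeasurableSet T → μ T = ∑' p, μ (T ∩ C p) := by
    intro T hT
    rw [← measure_iUnion (fun p q hpq => (hCd hpq).mono Set.inter_subset_right
      Set.inter_subset_right) fun p => hT.inter (hCm p), ← Set.inter_iUnion]
    refine measure_congr ?_
    filter_upwards [hfin] with ω hω
    refine propext ⟨fun h => ⟨h, ?_⟩, fun h => h.1⟩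
    obtain ⟨k, hk⟩ := ENat.ne_top_iff_exists.1 hω
    exact Set.mem_iUnion.2 ⟨(k, pairIndex φ k ω), hk.symm, rfl⟩
  have hAm : MeasurableSet A := (refineFiltration hM.measurable_sample hφ hτ₀).le j A hA
  have hAh : MeasurableSet (A ∩ {ω | candidateHyp θ φ τ₀ ω = h}) :=
    hAm.inter (hh (measurableSet_singleton h))
  rw [hsum _ (hAh.inter (hX hB)), hsum _ hAh, ← ENNReal.tsum_mul_right]
  refine tsum_congr fun ⟨k, n⟩ => ?_
  have hpast := measurableSet_pastInfo_of_refineFiltration (θ := θ) hM.measurable_sample hφ hτ₀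
    j k n hA
  -- The second candidate's hypothesis is treated as part of the past, leaving only that of the
  -- sequence being sampled.
  have hpast' : MeasurableSet[pastInfo θ Y (k + j)]
      (A ∩ C (k, n) ∩ {ω | θ (2 * n + 1) ω = h.2}) :=
    MeasurableSet.inter hpast (measurable_hyp_pastInfo _ _ (measurableSet_singleton h.2))
  have e := hM.measure_past_inter_sample hf₀ hf₁ (2 * n) (k + j) h.1 hpast' hB
  have e1 : A ∩ {ω | candidateHyp θ φ τ₀ ω = h} ∩ C (k, n) =
      A ∩ C (k, n) ∩ {ω | θ (2 * n + 1) ω = h.2} ∩ {ω | θ (2 * n) ω = h.1} := by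
    ext ω
    by_cases hω : ω ∈ C (k, n)
    · have h1 : τ₀ ω = k := hω.1
      have h2 : pairIndex φ k ω = n := hω.2
      simp only [Set.mem_inter_iff, Set.mem_ofPred_eq, hω, candidateHyp, h1, h2,
        ENat.toNat_natCast, Prod.ext_iff]
      tauto
    · simp [hω]
  have e2 : A ∩ {ω | candidateHyp θ φ τ₀ ω = h} ∩ refineObs Y φ τ₀ (j + 1) ⁻¹' B ∩ C (k, n) =
      A ∩ C (k, n) ∩ {ω | θ (2 * n + 1) ω = h.2} ∩ {ω | θ (2 * n) ω = h.1} ∩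
        Y (2 * n) (k + j + 1) ⁻¹' B := by
    rw [Set.inter_right_comm, e1]
    ext ω
    by_cases hω : ω ∈ C (k, n)
    · have h1 : τ₀ ω = k := hω.1
      have h2 : pairIndex φ k ω = n := hω.2
      simp [refineObs, h1, h2, add_assoc]
    · simp [hω]
  rw [e1, e2, e]

theorem refineFiltration_zero (hY : ∀ s k, Measurable (Y s k))
    (hφ : IsSwitchingRule Y φ) (hτ₀ : IsStoppingTime (scanFiltration hY hφ) τ₀) :
    refineFiltration hY hφ hτ₀ 0 = hτ₀.measurableSpace := by
  change hτ₀.measurableSpace ⊔ ⨆ i ∈ Finset.Icc 1 0, _ = _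
  simp

theorem refineFiltration_succ (hY : ∀ s k, Measurable (Y s k))
    (hφ : IsSwitchingRule Y φ) (hτ₀ : IsStoppingTime (scanFiltration hY hφ) τ₀) (j : ℕ) :
    refineFiltration hY hφ hτ₀ (j + 1) = refineFiltration hY hφ hτ₀ j ⊔
      MeasurableSpace.comap (refineObs Y φ τ₀ (j + 1)) inferInstance := by
  change hτ₀.measurableSpace ⊔ ⨆ i ∈ Finset.Icc 1 (j + 1), _ =
    (hτ₀.measurableSpace ⊔ ⨆ i ∈ Finset.Icc 1 j, _) ⊔ _
  rw [← Finset.insert_Icc_right_eq_Icc_add_one (by omega), Finset.iSup_insert, sup_assoc,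
    sup_comm (MeasurableSpace.comap _ _)]

end Model

/-! ### The first optimal stopping time -/

section FirstStop

variable {Ω : Type*} {f₀ f₁ : ℝ → ℝ} {c : ℝ} {V : (Bool × Bool → ℝ) → ℝ}
  {r : ℕ → Ω → Bool × Bool → ℝ} {ω : Ω} {n : ℕ}

theorem firstStop_le_iff : firstStop f₀ f₁ c V r ω ≤ n ↔
    ∃ j ≤ n, stopCost (r j ω) ≤ c + expectNext f₀ f₁ V (r j ω) := by
  constructor
  · intro h
    by_contra! hcon
    have h1 : ((n + 1 : ℕ) : ℕ∞) ≤ firstStop f₀ f₁ c V r ω := by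
      refine le_iInf₂ fun j hj => ?_
      by_contra! hjn
      have hjn' : j < n + 1 := by exact_mod_cast hjn
      exact absurd hj (not_le.2 (hcon j (Nat.lt_succ_iff.1 hjn')))
    exact absurd (h1.trans h) (by exact_mod_cast Nat.not_succ_le_self n)
  · rintro ⟨j, hj, hc⟩
    exact (iInf₂_le j hc).trans (by exact_mod_cast hj)

theorem lt_of_lt_firstStop (h : (n : ℕ∞) < firstStop f₀ f₁ c V r ω) :
    c + expectNext f₀ f₁ V (r n ω) < stopCost (r n ω) := by
  by_contra! hcon
  exact absurd (firstStop_le_iff.2 ⟨n, le_rfl, hcon⟩) (not_le.2 h)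

theorem le_of_firstStop_eq (h : firstStop f₀ f₁ c V r ω = n) :
    stopCost (r n ω) ≤ c + expectNext f₀ f₁ V (r n ω) := by
  obtain ⟨j, hj, hc⟩ := firstStop_le_iff.1 h.le
  have h1 : (n : ℕ∞) ≤ j := h.symm.le.trans (iInf₂_le j hc)
  have h2 : j = n := le_antisymm hj (by exact_mod_cast h1)
  exact h2 ▸ hc

theorem isStoppingTime_firstStop [mΩ : MeasurableSpace Ω] {G : Filtration ℕ mΩ}
    (hf₀ : IsPDF f₀) (hf₁ : IsPDF f₁) (hV : Measurable V) (hr : ∀ j, Measurable[G j] (r j)) :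
    IsStoppingTime G (firstStop f₀ f₁ c V r) := by
  intro n
  have : {ω | firstStop f₀ f₁ c V r ω ≤ n} =
      ⋃ j ∈ Finset.range (n + 1), r j ⁻¹' {x | stopCost x ≤ c + expectNext f₀ f₁ V x} := by
    ext ω
    simp [firstStop_le_iff]
  change MeasurableSet[G n] {ω | firstStop f₀ f₁ c V r ω ≤ n}
  rw [this]
  refine Finset.measurableSet_biUnion _ fun j hj => G.mono
    (Nat.lt_succ_iff.1 (Finset.mem_range.1 hj)) _ (hr j (measurableSet_le measurable_stopCost
      ((measurable_expectNext hf₀ hf₁ hV).const_add c)))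

end FirstStop

/-! ### Verification along the posterior process -/

section Verification

variable {Ω : Type*} {m : MeasurableSpace Ω} [mΩ : MeasurableSpace Ω] {μ : Measure Ω}
  [IsProbabilityMeasure μ]
  {f₀ f₁ : ℝ → ℝ} {c : ℝ} {V : (Bool × Bool → ℝ) → ℝ} {hyp : Ω → Bool × Bool}
  {G : Filtration ℕ mΩ} {X : ℕ → Ω → ℝ}

theorem setLIntegral_posterior_le_refineCost (hf₀ : IsPDF f₀) (hf₁ : IsPDF f₁) (hc : 0 < c)
    (hV : IsBellmanSolution f₀ f₁ c V) (hhyp : Measurable hyp)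
    (hX : ∀ j, IsNextObs f₀ f₁ μ hyp (G j) (X (j + 1)))
    (hG : ∀ j, G (j + 1) = G j ⊔ MeasurableSpace.comap (X (j + 1)) inferInstance)
    {τ : Ω → ℕ∞} (hτ : IsStoppingTime G τ) {s : Set Ω} (hs : MeasurableSet[G 0] s) :
    ∫⁻ ω in s, ENNReal.ofReal (V (posterior μ hyp (G 0) ω)) ∂μ ≤
      ∫⁻ ω in s, refineCost c (fun j => posterior μ hyp (G j)) τ ω ∂μ := by
  have hVn := fun r hr => hV.nonneg hf₀ hf₁ hc (r := r) hr
  refine le_setLIntegral_cost (W := fun j ω => ENNReal.ofReal (V (posterior μ hyp (G j) ω)))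
    (N := fun j ω => ENNReal.ofReal (expectNext f₀ f₁ V (posterior μ hyp (G j) ω)))
    (S := fun j ω => ENNReal.ofReal (stopCost (posterior μ hyp (G j) ω)))
    hτ hs (ENNReal.ofReal_pos.2 hc).ne' (fun n A hA => ?_) (fun n => ?_) (fun n => ?_)
    fun n => ?_
  · exact setLIntegral_posterior_next hf₀ hf₁ (G.le n) hhyp (hX n) (hG n) hV.measurable
      (hV.abs_le_one hf₀ hf₁ hc) hVn hA
  · filter_upwards [posterior_mem_stdSimplex (G.le n) hhyp] with ω hr
    exact ENNReal.ofReal_le_ofReal (hV.le_stopCost hr)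
  · filter_upwards [posterior_mem_stdSimplex (G.le n) hhyp] with ω hr
    refine (ENNReal.ofReal_le_ofReal ?_).trans ENNReal.ofReal_add_le
    rw [hV.bellman _ hr]
    exact min_le_right _ _
  · filter_upwards [posterior_mem_stdSimplex (G.le n) hhyp] with ω hr
    exact ENNReal.ofReal_le_one.2 ((le_abs_self _).trans (hV.abs_le_one hf₀ hf₁ hc _ hr))

/-- Before the first stopping time the minimum in the Bellman equation is the continuation term, and
at that time it is the stopping cost. These are the equality conditions of `setLIntegral_cost_le`.
-/
theorem setLIntegral_refineCost_firstStop (hf₀ : IsPDF f₀) (hf₁ : IsPDF f₁) (hc : 0 < c)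
    (hV : IsBellmanSolution f₀ f₁ c V) (hhyp : Measurable hyp)
    (hX : ∀ j, IsNextObs f₀ f₁ μ hyp (G j) (X (j + 1)))
    (hG : ∀ j, G (j + 1) = G j ⊔ MeasurableSpace.comap (X (j + 1)) inferInstance)
    {s : Set Ω} (hs : MeasurableSet[G 0] s) :
    ∫⁻ ω in s, ENNReal.ofReal (V (posterior μ hyp (G 0) ω)) ∂μ =
      ∫⁻ ω in s, refineCost c (fun j => posterior μ hyp (G j))
        (firstStop f₀ f₁ c V fun j => posterior μ hyp (G j)) ω ∂μ := by
  have hτ : IsStoppingTime G (firstStop f₀ f₁ c V fun j => posterior μ hyp (G j)) :=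
    isStoppingTime_firstStop hf₀ hf₁ hV.measurable fun j => measurable_posterior
  have hVn := fun r hr => hV.nonneg hf₀ hf₁ hc (r := r) hr
  refine le_antisymm
    (setLIntegral_posterior_le_refineCost hf₀ hf₁ hc hV hhyp hX hG hτ hs) ?_
  refine setLIntegral_cost_le (W := fun j ω => ENNReal.ofReal (V (posterior μ hyp (G j) ω)))
    (N := fun j ω => ENNReal.ofReal (expectNext f₀ f₁ V (posterior μ hyp (G j) ω)))
    (S := fun j ω => ENNReal.ofReal (stopCost (posterior μ hyp (G j) ω)))
    hτ hs (ENNReal.ofReal_pos.2 hc).ne' (fun n => ?_) (fun n A hA => ?_) (fun n => ?_)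
    fun n => ?_
  · exact (hV.measurable.comp (measurable_posterior.mono (G.le n) le_rfl)).ennreal_ofReal
  · exact setLIntegral_posterior_next hf₀ hf₁ (G.le n) hhyp (hX n) (hG n) hV.measurable
      (hV.abs_le_one hf₀ hf₁ hc) hVn hA
  · filter_upwards [posterior_mem_stdSimplex (G.le n) hhyp] with ω hr hn
    rw [hV.bellman _ hr, min_eq_right (lt_of_lt_firstStop hn).le,
      ENNReal.ofReal_add hc.le (hV.expectNext_nonneg hf₀ hf₁ hc hr)]
  · filter_upwards [posterior_mem_stdSimplex (G.le n) hhyp] with ω hr hn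
    rw [hV.bellman _ hr, min_eq_left (le_of_firstStop_eq hn)]

theorem integrable_comp_posterior (hm : m ≤ mΩ) (hhyp : Measurable hyp)
    (hV : Measurable V) {M : ℝ} (hM : ∀ r ∈ stdSimplex ℝ (Bool × Bool), |V r| ≤ M) :
    Integrable (fun ω => V (posterior μ hyp m ω)) μ := by
  refine (integrable_const M).mono'
    (hV.comp (measurable_posterior.mono hm le_rfl)).aestronglyMeasurable ?_
  filter_upwards [posterior_mem_stdSimplex hm hhyp] with ω hr
  exact hM _ hr

/-- The integral identity holds on all events of `G j`, and the prediction is a function of the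
posterior alone, so conditioning on the smaller σ-algebra of the posterior gives the same answer. -/
theorem condExp_posterior_next (hf₀ : IsPDF f₀) (hf₁ : IsPDF f₁) (hc : 0 < c)
    (hV : IsBellmanSolution f₀ f₁ c V) (hhyp : Measurable hyp)
    (hX : ∀ j, IsNextObs f₀ f₁ μ hyp (G j) (X (j + 1)))
    (hG : ∀ j, G (j + 1) = G j ⊔ MeasurableSpace.comap (X (j + 1)) inferInstance) (j : ℕ) :
    μ[fun ω => V (posterior μ hyp (G (j + 1)) ω) |
        MeasurableSpace.comap (posterior μ hyp (G j)) inferInstance] =ᵐ[μ]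
      fun ω => expectNext f₀ f₁ V (posterior μ hyp (G j) ω) := by
  have hVn := fun r hr => hV.nonneg hf₀ hf₁ hc (r := r) hr
  have hle : MeasurableSpace.comap (posterior μ hyp (G j)) inferInstance ≤ G j :=
    measurable_posterior.comap_le
  have hN := measurable_expectNext hf₀ hf₁ hV.measurable
  have hint1 := integrable_comp_posterior (μ := μ) (G.le (j + 1)) hhyp hV.measurable
    (hV.abs_le_one hf₀ hf₁ hc)
  have hint2 := integrable_comp_posterior (μ := μ) (G.le j) hhyp hN
    (hV.abs_expectNext_le_one hf₀ hf₁ hc)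
  refine (ae_eq_condExp_of_forall_setIntegral_eq (hle.trans (G.le j)) hint1
    (fun s _ _ => hint2.integrableOn) (fun s hs _ => ?_) ?_).symm
  · have hs' := hle s hs
    rw [integral_eq_lintegral_of_nonneg_ae _ hint2.integrableOn.aestronglyMeasurable,
      integral_eq_lintegral_of_nonneg_ae _ hint1.integrableOn.aestronglyMeasurable,
      setLIntegral_posterior_next hf₀ hf₁ (G.le j) hhyp (hX j) (hG j) hV.measurable
        (hV.abs_le_one hf₀ hf₁ hc) hVn hs']
    · filter_upwards [ae_restrict_of_ae (posterior_mem_stdSimplex (G.le (j + 1)) hhyp)] with ω hr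
      exact hVn _ hr
    · filter_upwards [ae_restrict_of_ae (posterior_mem_stdSimplex (G.le j) hhyp)] with ω hr
      exact hV.expectNext_nonneg hf₀ hf₁ hc hr
  · exact (hN.comp (comap_measurable _)).stronglyMeasurable.aestronglyMeasurable

end Verification

end MixedSearch

theorem mainTheorem3 (f₀ f₁ : ℝ → ℝ) (hf₀ : IsPDF f₀) (hf₁ : IsPDF f₁)
    (hac₀₁ : pdfMeasure f₀ ≪ pdfMeasure f₁) (hac₁₀ : pdfMeasure f₁ ≪ pdfMeasure f₀)
    (hne : pdfMeasure f₀ ≠ pdfMeasure f₁) (c : ℝ) (hc : 0 < c) :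
    (∃ V : (Bool × Bool → ℝ) → ℝ, IsBellmanSolution f₀ f₁ c V) ∧
    ∀ V : (Bool × Bool → ℝ) → ℝ, IsBellmanSolution f₀ f₁ c V →
    ∀ {Ω : Type*} [MeasurableSpace Ω] (μ : Measure Ω) [IsProbabilityMeasure μ]
      (π₀ : ℝ) (_ : 0 ≤ π₀) (_ : π₀ ≤ 1) (θ : ℕ → Ω → Bool) (Y : ℕ → ℕ → Ω → ℝ)
      (hM : IsSearchModel f₀ f₁ π₀ μ θ Y)
      (φ : ℕ → Ω → Bool) (hφ : IsSwitchingRule Y φ)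
      (τ₀ : Ω → ℕ∞) (hτ₀ : IsStoppingTime (scanFiltration hM.measurable_sample hφ) τ₀)
      (_ : ∀ᵐ ω ∂μ, τ₀ ω ≠ ⊤),
      let G := refineFiltration hM.measurable_sample hφ hτ₀
      let r := posteriorVec μ θ hM.measurable_sample hφ hτ₀
      -- the refinement cost is `V(r₀)`
      (∀ᵐ ω ∂μ, 0 ≤ V (r 0 ω)) ∧
      IsEssInf μ hτ₀.measurableSpace (condCosts c μ hτ₀.measurableSpace G r)
        (fun ω => ENNReal.ofReal (V (r 0 ω))) ∧
      -- the recursion for `V` along the posterior process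
      (∀ j, Integrable (fun ω => V (r (j + 1) ω)) μ ∧
        μ[fun ω => V (r (j + 1) ω) | MeasurableSpace.comap (r j) inferInstance]
          =ᵐ[μ] (fun ω => expectNext f₀ f₁ V (r j ω)) ∧
        (fun ω => V (r j ω)) =ᵐ[μ] fun ω => min (stopCost (r j ω))
          (c + (μ[fun ω' => V (r (j + 1) ω') |
            MeasurableSpace.comap (r j) inferInstance]) ω)) ∧
      -- the first time that stopping costs at most as much as continuing is optimal
      IsStoppingTime G (firstStop f₀ f₁ c V r) ∧
      μ⁻[refineCost c r (firstStop f₀ f₁ c V r) | hτ₀.measurableSpace]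
        =ᵐ[μ] fun ω => ENNReal.ofReal (V (r 0 ω)) := by
  refine ⟨exists_isBellmanSolution hf₀ hf₁ hc, ?_⟩
  intro V hV Ω _ μ _ π₀ _ _ θ Y hM φ hφ τ₀ hτ₀ hfin G r
  have hhyp : Measurable (candidateHyp θ φ τ₀) :=
    measurable_candidateHyp hM.measurable_hyp hM.measurable_sample hφ hτ₀
  have hX : ∀ j, IsNextObs f₀ f₁ μ (candidateHyp θ φ τ₀) (G j) (refineObs Y φ τ₀ (j + 1)) :=
    hM.isNextObs hf₀ hf₁ hφ hτ₀ hfin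
  have hG : ∀ j, G (j + 1) =
      G j ⊔ MeasurableSpace.comap (refineObs Y φ τ₀ (j + 1)) inferInstance :=
    refineFiltration_succ hM.measurable_sample hφ hτ₀
  have hG0 : G 0 = hτ₀.measurableSpace := refineFiltration_zero hM.measurable_sample hφ hτ₀
  have hle : hτ₀.measurableSpace ≤ _ := hτ₀.measurableSpace_le
  have hsimplex : ∀ j, ∀ᵐ ω ∂μ, r j ω ∈ stdSimplex ℝ (Bool × Bool) := fun j =>
    posterior_mem_stdSimplex (G.le j) hhyp
  have hVr : Measurable[hτ₀.measurableSpace] fun ω => ENNReal.ofReal (V (r 0 ω)) := by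
    have hr0 : Measurable[hτ₀.measurableSpace] (r 0) := hG0 ▸ measurable_posterior
    exact ENNReal.measurable_ofReal.comp (hV.measurable.comp hr0)
  have hfinal : IsStoppingTime G (firstStop f₀ f₁ c V r) :=
    isStoppingTime_firstStop hf₀ hf₁ hV.measurable fun j => measurable_posterior
  have hopt : μ⁻[refineCost c r (firstStop f₀ f₁ c V r) | hτ₀.measurableSpace]
      =ᵐ[μ] fun ω => ENNReal.ofReal (V (r 0 ω)) :=
    (ae_eq_condLExp hle μ _ hVr fun s hs => setLIntegral_refineCost_firstStop hf₀ hf₁ hc hV hhyp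
      hX hG (hG0 ▸ hs)).symm
  refine ⟨?_, ⟨hVr, ?_, ?_⟩, fun j => ?_, hfinal, hopt⟩
  · filter_upwards [hsimplex 0] with ω hr
    exact hV.nonneg hf₀ hf₁ hc hr
  -- Both sides are measurable for the initial σ-algebra, so integrals over its events decide the
  -- inequality; it is proved for the trimmed measure and lifted to `μ`.
  · rintro _ ⟨τ₁, hτ₁, rfl⟩
    refine ae_le_of_ae_le_trim (hm := hle) (ae_le_of_forall_setLIntegral_le_of_sigmaFinite hVr
      fun s hs _ => ?_)
    rw [setLIntegral_condLExp_trim hle μ _ hs, setLIntegral_trim hle hVr hs]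
    exact setLIntegral_posterior_le_refineCost hf₀ hf₁ hc hV hhyp hX hG hτ₁ (hG0 ▸ hs)
  -- The value is itself attained in the family, at the first stopping time, so every lower bound
  -- lies below it.
  · intro u _ hu
    exact (hu _ ⟨_, hfinal, rfl⟩).trans hopt.le
  · have hcond := condExp_posterior_next hf₀ hf₁ hc hV hhyp hX hG j
    refine ⟨integrable_comp_posterior (G.le (j + 1)) hhyp hV.measurable
      (hV.abs_le_one hf₀ hf₁ hc), hcond, ?_⟩
    filter_upwards [hcond, hsimplex j] with ω h1 hr
    rw [hV.bellman _ hr]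
    exact congrArg (fun x => min (stopCost (r j ω)) (c + x)) h1.symm
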